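/- Let $p$ be a prime. **Definitions.** A *numerical ring* is a commutative ring $R$ with operations $r\mapsto\binom rn$ ($n\ge 0$) such that $\binom r0=1$, $\binom r1=r$, $\binom 0n=0$ for $n\ge1$, $\binom 1n=0$ for $n\ge 2$, $\binom{r+s}n=\sum_{i+j=n}\binom ri\binom sj$, and such that the identities which on $\mathbb Z$ express $\binom xm\binom xn$ and $\binom{\binom xm}n$ as $\mathbb Z$-linear combinations of the functions $\binom xk$, and $\binom{xy}n$ as a $\mathbb Z$-bilinear combination of the $\binom xi$ and $\binom yj$, also hold in $R$. Homomorphisms of numerical rings are the ring homomorphisms that commute with these operations. Let $\mathcal N$ be the class of simplicial schemes isomorphic to the degreewise spectrum of a cosimplicial numerical ring which in each degree is the free numerical ring on some finite set. For a simplicial scheme $X$ and a commutative ring $A$, $X(A)$ is the simplicial set with $X(A)_n=\operatorname{Hom}(\operatorname{Spec}A,X_n)$. A *$\mathbb Z_p$-numerical function* between finitely generated free $\mathbb Z_p$-modules is a function which in coordinates is given by polynomials with coefficients in $\mathbb Q_p$. Let $X$ be a simplicial object in the category of finitely generated free $\mathbb Z_p$-modules and $\mathbb Z_p$-numerical functions;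 denote its underlying simplicial set by $X(\mathbb Z_p)$. The functions $X_n\to\mathbb Z_p$ form a cosimplicial $\mathbb Z_p$-module, whose associated (alternating sum) cochain complex computes the ordinary cohomology $H^*(X(\mathbb Z_p),\mathbb Z_p)$; the $\mathbb Z_p$-numerical functions, and the functions continuous for the $p$-adic topologies on $X_n$ and $\mathbb Z_p$, form subcomplexes. Call $X$ a *$\mathbb Z_p$-numerical space* if $X(\mathbb Z_p)$ is connected and the inclusion of the subcomplex of numerical cochains induces an isomorphism on cohomology in every degree. (No finiteness of the cohomology is required.) **Proposition.** (i) If $X\in\mathcal N$, then the reduction mod $p$ map $X(\mathbb Z_p)\to X(\mathbb Z/p)$ is a bijection in every simplicial degree. (ii) If $X$ is a $\mathbb Z_p$-numerical space, then the inclusion of the complex of $p$-adically continuous $\mathbb Z_p$-valued cochains into the complex of all $\mathbb Z_p$-valued cochains induces an isomorphism from its cohomology to the ordinary cohomology $H^i(X(\mathbb Z_p),\mathbb Z_p)$ for every $i\ge0$. -/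

import Mathlib

open CategoryTheory Opposite AlgebraicGeometry

/-! ### Numerical rings -/

/-- A numerical ring: a commutative ring with operations `r ↦ binom n r` (thought of as
`r choose n`) obeying the identities satisfied by the binomial functions on `ℤ`.
In the last three axioms the coefficients `c` range over the (unique) finitely supported families of
integers for which the corresponding identity between binomial functions holds on `ℤ`:
`(x choose m)(x choose n)` is a `ℤ`-linear combination of the functions `x choose k`,
`xy choose n` is a `ℤ`-bilinear combination of the `x choose i` and `y choose j`,
and `(x choose m) choose n` is a `ℤ`-linear combination of the `x choose k`. -/
class NumericalRing (R : Type) [CommRing R] where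
  binom : ℕ → R → R
  binom_index_zero : ∀ r : R, binom 0 r = 1
  binom_zero : ∀ n : ℕ, 1 ≤ n → binom n 0 = 0
  binom_one : ∀ n : ℕ, 2 ≤ n → binom n 1 = 0
  binom_index_one : ∀ r : R, binom 1 r = r
  binom_add : ∀ (n : ℕ) (r s : R),
    binom n (r + s) = ∑ ij ∈ Finset.HasAntidiagonal.antidiagonal n, binom ij.1 r * binom ij.2 s
  binom_mul_binom : ∀ (m n : ℕ) (c : ℕ →₀ ℤ),
    (∀ x : ℤ, Ring.choose x m * Ring.choose x n = c.sum fun k a => a * Ring.choose x k) →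
    ∀ r : R, binom m r * binom n r = c.sum fun k a => (a : R) * binom k r
  binom_mul : ∀ (n : ℕ) (c : ℕ × ℕ →₀ ℤ),
    (∀ x y : ℤ, Ring.choose (x * y) n =
      c.sum fun ij a => a * (Ring.choose x ij.1 * Ring.choose y ij.2)) →
    ∀ r s : R, binom n (r * s) = c.sum fun ij a => (a : R) * (binom ij.1 r * binom ij.2 s)
  binom_binom : ∀ (m n : ℕ) (c : ℕ →₀ ℤ),
    (∀ x : ℤ, Ring.choose (Ring.choose x m) n = c.sum fun k a => a * Ring.choose x k) →
    ∀ r : R, binom n (binom m r) = c.sum fun k a => (a : R) * binom k r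

/-- Homomorphisms of numerical rings: ring homomorphisms commuting with the binomial operations. -/
def IsNumericalHom {R S : Type} [CommRing R] [CommRing S] [NumericalRing R] [NumericalRing S]
    (φ : R →+* S) : Prop :=
  ∀ (n : ℕ) (r : R), φ (NumericalRing.binom n r) = NumericalRing.binom n (φ r)

/-- `R` is the free numerical ring on some finite set of elements. -/
def IsFreeFinitelyGenerated (R : Type) [CommRing R] [NumericalRing R] : Prop :=
  ∃ (k : ℕ) (x : Fin k → R), ∀ (S : Type) [CommRing S] [NumericalRing S] (s : Fin k → S),
    ∃! φ : R →+* S, IsNumericalHom φ ∧ ∀ i, φ (x i) = s i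

/-! ### The category of simplicial schemes `𝒩`, points and reduction -/

/-- The simplicial schemes isomorphic to the degreewise spectrum of a cosimplicial numerical ring
that is a free finitely generated numerical ring in each degree. -/
def IsNumericalSimplicialScheme (X : SimplicialObject Scheme.{0}) : Prop :=
  ∃ (R : CosimplicialObject CommRingCat.{0}) (_ : ∀ n : SimplexCategory, NumericalRing (R.obj n)),
    (∀ (m n : SimplexCategory) (θ : m ⟶ n), IsNumericalHom (R.map θ).hom) ∧
    (∀ n : SimplexCategory, IsFreeFinitelyGenerated (R.obj n)) ∧
    Nonempty (X ≅ Functor.op R ⋙ Scheme.Spec)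

/-- The simplicial set `X(A)` of `A`-points of a simplicial scheme `X`:
`X(A)_n` is the set of morphisms `Spec A ⟶ X_n`. -/
noncomputable def schemePoints (X : SimplicialObject Scheme.{0}) (A : CommRingCat.{0}) : SSet.{0} :=
  X ⋙ coyoneda.obj (op (Spec A))

/-- The map of simplicial sets `X(A) ⟶ X(B)` induced by a ring homomorphism `A ⟶ B`. -/
noncomputable def schemePointsMap (X : SimplicialObject Scheme.{0}) {A B : CommRingCat.{0}} (φ : A ⟶ B) :
    schemePoints X A ⟶ schemePoints X B :=
  Functor.whiskerLeft X (coyoneda.map (Spec.map φ).op)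

/-- Reduction mod `p`, `X(ℤ_p) ⟶ X(ℤ/p)`. -/
noncomputable def reductionModP (p : ℕ) [Fact p.Prime] (X : SimplicialObject Scheme.{0}) :
    schemePoints X (CommRingCat.of ℤ_[p]) ⟶ schemePoints X (CommRingCat.of (ZMod p)) :=
  schemePointsMap X (CommRingCat.ofHom (PadicInt.toZMod (p := p)))

/-! ### `ℤ_p`-numerical functions -/

section Numerical

variable (p : ℕ) [Fact p.Prime]

/-- A function between finitely generated free `ℤ_p`-modules is (`ℤ_p`-)numerical if in coordinates
(with respect to some, equivalently any, bases) it is given by polynomials with coefficients in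
`ℚ_p = ℤ_p ⊗ ℚ`. -/
def IsNumericalFunction {M N : Type} [AddCommGroup M] [Module ℤ_[p] M]
    [AddCommGroup N] [Module ℤ_[p] N] (f : M → N) : Prop :=
  ∃ (m n : ℕ) (e : M ≃ₗ[ℤ_[p]] (Fin m → ℤ_[p])) (e' : N ≃ₗ[ℤ_[p]] (Fin n → ℤ_[p]))
    (P : Fin n → MvPolynomial (Fin m) ℚ_[p]), ∀ (x : M) (j : Fin n),
      ((e' (f x) j : ℤ_[p]) : ℚ_[p]) =
        MvPolynomial.eval (fun i => ((e x i : ℤ_[p]) : ℚ_[p])) (P j)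

variable {p}
variable {M N L : Type} [AddCommGroup M] [Module ℤ_[p] M]
  [AddCommGroup N] [Module ℤ_[p] N] [AddCommGroup L] [Module ℤ_[p] L]

/-- A linear map in coordinates is given by linear polynomials. -/
theorem linear_coordinates {m n : ℕ} (e : M ≃ₗ[ℤ_[p]] (Fin m → ℤ_[p]))
    (φ : M →ₗ[ℤ_[p]] (Fin n → ℤ_[p])) :
    ∃ A : Fin n → MvPolynomial (Fin m) ℚ_[p], ∀ (x : M) (j : Fin n),
      ((φ x j : ℤ_[p]) : ℚ_[p]) =
        MvPolynomial.eval (fun i => ((e x i : ℤ_[p]) : ℚ_[p])) (A j) := by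
  refine ⟨fun j => ∑ i, MvPolynomial.C ((φ (e.symm (Pi.single i 1)) j : ℤ_[p]) : ℚ_[p]) *
    MvPolynomial.X i, fun x j => ?_⟩
  have hx : x = ∑ i, e x i • e.symm (Pi.single i 1) := by
    apply e.injective
    rw [map_sum]
    simp only [map_smul, LinearEquiv.apply_symm_apply]
    ext k
    simp [Finset.sum_apply, Pi.single_apply]
  conv_lhs => rw [hx]
  simp only [map_sum, map_smul, Finset.sum_apply, Pi.smul_apply, smul_eq_mul, map_mul,
    MvPolynomial.eval_C, MvPolynomial.eval_X]
  rw [PadicInt.coe_sum]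
  simp [mul_comm]

/-- The coordinates of the source and target may be chosen freely. -/
theorem IsNumericalFunction.coordinates {f : M → N} (hf : IsNumericalFunction p f) {m n : ℕ}
    (e : M ≃ₗ[ℤ_[p]] (Fin m → ℤ_[p])) (φ : N →ₗ[ℤ_[p]] (Fin n → ℤ_[p])) :
    ∃ P : Fin n → MvPolynomial (Fin m) ℚ_[p], ∀ (x : M) (j : Fin n),
      ((φ (f x) j : ℤ_[p]) : ℚ_[p]) =
        MvPolynomial.eval (fun i => ((e x i : ℤ_[p]) : ℚ_[p])) (P j) := by
  obtain ⟨m₁, n₁, e₁, e₁', Q, hQ⟩ := hf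
  obtain ⟨A, hA⟩ := linear_coordinates e e₁.toLinearMap
  obtain ⟨B, hB⟩ := linear_coordinates e₁' φ
  refine ⟨fun j => MvPolynomial.bind₁ (fun k => MvPolynomial.bind₁ A (Q k)) (B j),
    fun x j => ?_⟩
  rw [hB]
  simp only [← MvPolynomial.aeval_eq_eval, MvPolynomial.aeval_bind₁] at hA hQ ⊢
  simp only [hQ]
  simp only [← hA]
  rfl

theorem IsNumericalFunction.comp {g : N → L} {f : M → N} (hg : IsNumericalFunction p g)
    (hf : IsNumericalFunction p f) : IsNumericalFunction p (g ∘ f) := by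
  obtain ⟨n₁, l, e₁, e', Q, hQ⟩ := id hg
  obtain ⟨m, _, e, _, _, _⟩ := id hf
  obtain ⟨P, hP⟩ := hf.coordinates e e₁.toLinearMap
  refine ⟨m, l, e, e', fun j => MvPolynomial.bind₁ P (Q j), fun x j => ?_⟩
  simp only [← MvPolynomial.aeval_eq_eval, MvPolynomial.aeval_bind₁] at hP hQ ⊢
  simp only [Function.comp_apply, hQ]
  simp only [← hP]
  rfl

theorem exists_coordinates [Module.Finite ℤ_[p] M] [Module.Free ℤ_[p] M] :
    ∃ m : ℕ, Nonempty (M ≃ₗ[ℤ_[p]] (Fin m → ℤ_[p])) :=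
  ⟨_, ⟨(Module.finBasis ℤ_[p] M).equivFun⟩⟩

theorem isNumericalFunction_id [Module.Finite ℤ_[p] M] [Module.Free ℤ_[p] M] :
    IsNumericalFunction p (id : M → M) := by
  obtain ⟨m, ⟨e⟩⟩ := exists_coordinates (p := p) (M := M)
  exact ⟨m, m, e, e, fun j => MvPolynomial.X j, fun x j => by simp⟩

/-- `ℤ_p`-valued numerical functions are those given by one polynomial in given coordinates. -/
theorem isNumericalFunction_iff {m : ℕ} (e : M ≃ₗ[ℤ_[p]] (Fin m → ℤ_[p])) (f : M → ℤ_[p]) :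
    IsNumericalFunction p f ↔ ∃ P : MvPolynomial (Fin m) ℚ_[p], ∀ x : M,
      (f x : ℚ_[p]) = MvPolynomial.eval (fun i => ((e x i : ℤ_[p]) : ℚ_[p])) P := by
  constructor
  · intro hf
    obtain ⟨P, hP⟩ := hf.coordinates e (LinearMap.pi fun _ : Fin 1 => LinearMap.id)
    exact ⟨P 0, fun x => hP x 0⟩
  · rintro ⟨P, hP⟩
    exact ⟨m, 1, e, (LinearEquiv.funUnique (Fin 1) ℤ_[p] ℤ_[p]).symm, fun _ => P,
      fun x j => hP x⟩

/-- The `p`-adic topology on a `ℤ_p`-module. -/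
@[reducible] noncomputable def padicTopology (p : ℕ) [Fact p.Prime] (M : Type) [AddCommGroup M]
    [Module ℤ_[p] M] : TopologicalSpace M :=
  (Ideal.span {(p : ℤ_[p])}).adicModuleTopology M

theorem nhds_padicTopology (x : M) :
    (@nhds M (padicTopology p M) x).HasBasis (fun _ : ℕ => True) fun k =>
      {y | y - x ∈ Ideal.span {(p : ℤ_[p])} ^ k • (⊤ : Submodule ℤ_[p] M)} := by
  set I := Ideal.span {(p : ℤ_[p])}
  let := I.adic_basis.topology
  have h := (I.ringFilterBasis.moduleFilterBasis
    (I.adic_module_basis M)).toAddGroupFilterBasis.nhds_hasBasis x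
  refine h.to_hasBasis ?_ ?_
  · rintro U ⟨k, rfl⟩
    refine ⟨k, trivial, fun y hy => ⟨y - x, hy, by simp⟩⟩
  · intro k _
    refine ⟨_, ⟨k, rfl⟩, ?_⟩
    rintro _ ⟨z, hz, rfl⟩
    simpa using hz

theorem continuous_linear (φ : M →ₗ[ℤ_[p]] ℤ_[p]) :
    @Continuous M ℤ_[p] (padicTopology p M) _ φ := by
  let := padicTopology p M
  refine continuous_iff_continuousAt.2 fun x => ?_
  refine Metric.tendsto_nhds.2 fun ε hε => ?_
  have hp : (1 : ℝ) < p := by exact_mod_cast (Fact.out : p.Prime).one_lt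
  obtain ⟨k, hk⟩ := exists_pow_lt_of_lt_one hε (inv_lt_one_of_one_lt₀ hp)
  refine (nhds_padicTopology x).mem_iff.2 ⟨k, trivial, fun y hy => ?_⟩
  have hy' : φ (y - x) ∈ Ideal.span {(p : ℤ_[p]) ^ k} := by
    have h1 := Submodule.mem_map_of_mem (f := φ) (show y - x ∈ Ideal.span {(p : ℤ_[p])} ^ k • (⊤ : Submodule ℤ_[p] M) from hy)
    rw [Submodule.map_smul'', Ideal.span_singleton_pow] at h1
    exact (Submodule.smul_le.2 fun r hr n _ => Ideal.mul_mem_right n _ hr) h1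
  have h2 := (PadicInt.norm_le_pow_iff_mem_span_pow _ k).2 hy'
  change dist (φ y) (φ x) < ε
  rw [dist_eq_norm, ← map_sub]
  refine h2.trans_lt ?_
  rwa [zpow_neg, zpow_natCast, ← inv_pow]

theorem continuous_of_polynomial {m : ℕ} (e : M ≃ₗ[ℤ_[p]] (Fin m → ℤ_[p])) (f : M → ℤ_[p])
    (P : MvPolynomial (Fin m) ℚ_[p])
    (hP : ∀ x, (f x : ℚ_[p]) = MvPolynomial.eval (fun i => ((e x i : ℤ_[p]) : ℚ_[p])) P) :
    @Continuous M ℤ_[p] (padicTopology p M) _ f := by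
  let := padicTopology p M
  refine Continuous.subtype_mk (f := fun x => (f x : ℚ_[p])) ?_ fun x => (f x).2
  simp only [hP]
  refine (MvPolynomial.continuous_eval P).comp (continuous_pi fun i => ?_)
  exact continuous_subtype_val.comp (continuous_linear (LinearMap.proj i ∘ₗ e.toLinearMap))

/-- Numerical functions are continuous for the `p`-adic topologies. -/
theorem IsNumericalFunction.continuous {f : M → N} (hf : IsNumericalFunction p f) :
    @Continuous M N (padicTopology p M) (padicTopology p N) f := by
  let := padicTopology p M
  let := padicTopology p N
  obtain ⟨m, n, e, e', P, hP⟩ := hf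
  refine continuous_iff_continuousAt.2 fun x => (nhds_padicTopology (f x)).tendsto_right_iff.2 ?_
  intro k _
  have hp : (0 : ℝ) < p := by exact_mod_cast (Fact.out : p.Prime).pos
  have key : ∀ j : Fin n, ∀ᶠ y in nhds x,
      e' (f y) j - e' (f x) j ∈ Ideal.span {(p : ℤ_[p]) ^ k} := fun j => by
    have hc := continuous_of_polynomial e (fun y => e' (f y) j) (P j) fun y => hP y j
    have := Metric.tendsto_nhds.1 (hc.tendsto x) ((p : ℝ) ^ (-k : ℤ)) (zpow_pos hp _)
    filter_upwards [this] with y hy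
    rw [dist_eq_norm] at hy
    exact (PadicInt.norm_le_pow_iff_mem_span_pow _ k).1 hy.le
  filter_upwards [Filter.eventually_all.2 key] with y hy
  choose w hw using fun j => Ideal.mem_span_singleton'.1 (hy j)
  have hyx : f y - f x = (p : ℤ_[p]) ^ k • e'.symm w := by
    apply e'.injective
    ext j
    simp [← hw j, mul_comm]
  change f y - f x ∈ _
  rw [hyx]
  exact Submodule.smul_mem_smul
    (Ideal.pow_mem_pow (Ideal.mem_span_singleton_self _) k) Submodule.mem_top

end Numerical

/-! ### The category of `ℤ_p`-numerical objects -/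

/-- Finitely generated free `ℤ_p`-modules. -/
structure PadicNum (p : ℕ) [Fact p.Prime] where
  carrier : Type
  [addCommGroup : AddCommGroup carrier]
  [module : Module ℤ_[p] carrier]
  [finite : Module.Finite ℤ_[p] carrier]
  [free : Module.Free ℤ_[p] carrier]

attribute [instance] PadicNum.addCommGroup PadicNum.module PadicNum.finite PadicNum.free

/-- The category of finitely generated free `ℤ_p`-modules and `ℤ_p`-numerical functions. -/
instance (p : ℕ) [Fact p.Prime] : Category (PadicNum p) where
  Hom M N := {f : M.carrier → N.carrier // IsNumericalFunction p f}
  id M := ⟨id, isNumericalFunction_id⟩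
  comp f g := ⟨g.1 ∘ f.1, g.2.comp f.2⟩

/-- The forgetful functor to sets. -/
def PadicNum.forget (p : ℕ) [Fact p.Prime] : PadicNum p ⥤ Type where
  obj M := M.carrier
  map f := TypeCat.ofHom f.1

/-- The simplicial set underlying a simplicial `ℤ_p`-numerical object. -/
def underlyingSSet {p : ℕ} [Fact p.Prime] (X : SimplicialObject (PadicNum p)) : SSet.{0} :=
  X ⋙ PadicNum.forget p

/-! ### Cochains -/

/-- A class of `ℤ_p`-valued functions on finitely generated free `ℤ_p`-modules which is closed under
linear combinations and under composition with numerical functions. -/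
structure FunctionClass (p : ℕ) [Fact p.Prime] where
  functions : ∀ M : PadicNum p, Submodule ℤ_[p] (M.carrier → ℤ_[p])
  comp_mem : ∀ {M N : PadicNum p} (f : M ⟶ N) (u : N.carrier → ℤ_[p]),
    u ∈ functions N → u ∘ f.1 ∈ functions M

section Cochains

variable (p : ℕ) [Fact p.Prime]

/-- All functions. -/
noncomputable def allFunctions : FunctionClass p where
  functions _ := ⊤
  comp_mem _ _ _ := Submodule.mem_top

/-- The `ℤ_p`-valued numerical functions. -/
noncomputable def numericalFunctions : FunctionClass p where
  functions M :=
    { carrier := {u | IsNumericalFunction p u}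
      zero_mem' := by
        obtain ⟨m, ⟨e⟩⟩ := exists_coordinates (p := p) (M := M.carrier)
        exact (isNumericalFunction_iff e _).2 ⟨0, fun x => by simp⟩
      add_mem' := fun {u v} hu hv => by
        obtain ⟨m, ⟨e⟩⟩ := exists_coordinates (p := p) (M := M.carrier)
        obtain ⟨P, hP⟩ := (isNumericalFunction_iff e u).1 hu
        obtain ⟨Q, hQ⟩ := (isNumericalFunction_iff e v).1 hv
        exact (isNumericalFunction_iff e _).2 ⟨P + Q, fun x => by simp [hP, hQ]⟩
      smul_mem' := fun a u hu => by
        obtain ⟨m, ⟨e⟩⟩ := exists_coordinates (p := p) (M := M.carrier)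
        obtain ⟨P, hP⟩ := (isNumericalFunction_iff e u).1 hu
        exact (isNumericalFunction_iff e _).2
          ⟨MvPolynomial.C (a : ℚ_[p]) * P, fun x => by simp [hP]⟩ }
  comp_mem f _ hu := IsNumericalFunction.comp hu f.2

/-- The `ℤ_p`-valued functions that are continuous for the `p`-adic topology. -/
noncomputable def continuousFunctions : FunctionClass p where
  functions M :=
    { carrier := {u | @Continuous M.carrier ℤ_[p] (padicTopology p M.carrier) _ u}
      zero_mem' := by
        let := padicTopology p M.carrier
        exact continuous_const
      add_mem' := fun {u v} hu hv => by
        let := padicTopology p M.carrier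
        exact Continuous.add hu hv
      smul_mem' := fun a u hu => by
        let := padicTopology p M.carrier
        exact Continuous.const_smul hu a }
  comp_mem {M N} f u hu := by
    let := padicTopology p M.carrier
    let := padicTopology p N.carrier
    exact Continuous.comp hu f.2.continuous

variable {p}

/-- The cosimplicial `ℤ_p`-module `n ↦ {u : X_n → ℤ_p in the class S}`. -/
noncomputable def cosimplicialCochains (S : FunctionClass p) (X : SimplicialObject (PadicNum p)) :
    CosimplicialObject (ModuleCat.{0} ℤ_[p]) where
  obj n := ModuleCat.of ℤ_[p] (S.functions (X.obj (op n)))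
  map θ := ModuleCat.ofHom <|
    (LinearMap.funLeft ℤ_[p] ℤ_[p] (X.map θ.op).1).restrict fun u hu => S.comp_mem _ u hu
  map_id _ := by
    ext u x
    change u.1 ((X.map (𝟙 _)).1 x) = u.1 x
    rw [X.map_id]
    rfl
  map_comp θ η := by
    ext u x
    change u.1 ((X.map (η.op ≫ θ.op)).1 x) = u.1 ((X.map θ.op).1 ((X.map η.op).1 x))
    rw [X.map_comp]
    rfl

/-- The inclusion of the cochains in the class `S` into all cochains. -/
noncomputable def cosimplicialInclusion (S : FunctionClass p) (X : SimplicialObject (PadicNum p)) :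
    cosimplicialCochains S X ⟶ cosimplicialCochains (allFunctions p) X where
  app n := ModuleCat.ofHom (Submodule.inclusion le_top)
  naturality _ _ _ := rfl

/-- The cochain complex of `ℤ_p`-valued cochains on `X` in the class `S`, with differential the
alternating sum of the cofaces. For the class of all functions this is the complex computing the
ordinary cohomology of the underlying simplicial set with coefficients in `ℤ_p`. -/
noncomputable def cochains (S : FunctionClass p) (X : SimplicialObject (PadicNum p)) :
    CochainComplex (ModuleCat.{0} ℤ_[p]) ℕ :=
  (AlgebraicTopology.alternatingCofaceMapComplex _).obj (cosimplicialCochains S X)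

/-- The inclusion of complexes of the cochains in the class `S` into all cochains. -/
noncomputable def cochainsInclusion (S : FunctionClass p) (X : SimplicialObject (PadicNum p)) :
    cochains S X ⟶ cochains (allFunctions p) X :=
  (AlgebraicTopology.alternatingCofaceMapComplex _).map (cosimplicialInclusion S X)

/-- The natural map from the cohomology of the complex of cochains in the class `S` to the ordinary
cohomology of the underlying simplicial set with coefficients in `ℤ_p`. -/
noncomputable def toOrdinaryCohomology (S : FunctionClass p) (X : SimplicialObject (PadicNum p))
    (i : ℕ) : (cochains S X).homology i ⟶ (cochains (allFunctions p) X).homology i :=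
  HomologicalComplex.homologyMap (cochainsInclusion S X) i

/-- A `ℤ_p`-numerical space: a connected simplicial `ℤ_p`-numerical object whose cohomology with
`ℤ_p`-coefficients can be computed using `ℤ_p`-numerical cochains. (No finiteness of the cohomology
is required.) -/
structure IsPadicNumericalSpace (X : SimplicialObject (PadicNum p)) : Prop where
  connected : (underlyingSSet X).IsConnected
  isIso_cohomology : ∀ i : ℕ, IsIso (toOrdinaryCohomology (numericalFunctions p) X i)

end Cochains

/-! Part (ii). Let N ⊆ D ⊆ L be the complexes of numerical, continuous and all cochains. An
injection of complexes is an isomorphism on cohomology in all degrees exactly when its cokernel is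
acyclic, so acyclicity of L/N must be shown to imply acyclicity of L/D
(`IsAcyclicModulo.of_completion`). Both N and D are saturated in L: if `p • u` lies in one of them,
so does `u`. Mahler's theorem shows that every continuous function is congruent mod p to a numerical
one (`exists_numericalFunction_congr`). Hence N and D have the same image in L/p. A cochain whose
differential lies in D can therefore be written, up to p times another such cochain, as a coboundary
plus a numerical cochain. Iterating gives p-adic series, which converge in L and in D.

Part (i). Let R be a free numerical ring on k generators. As an abelian group it is spanned by
products of binomials of the generators, and these are unitriangular when evaluated at points with
natural coordinates. So an element whose values at all integral points are divisible by m is itself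
divisible by m (`IsFreeOn.dvd_of_forall_dvd_lift`). Fermat's little theorem at each point then gives
`r ^ p ≡ r` mod p in R, which forces two homomorphisms to ℤ_p that agree mod p to be equal. The same
divisibility shows that a homomorphism R → ℤ/p agrees on any finite set with evaluation at an
integral point. Compactness of ℤ_p^k turns these points into one p-adic point, whose evaluation is
the required lift. -/

/-! ### Cohomology isomorphisms and acyclicity of the relative complex. -/

section Homology

variable {R : Type} [Ring R] (K L : CochainComplex (ModuleCat.{0} R) ℕ)

theorem exists_cycle_of_d_eq_zero {n : ℕ} (x : K.X n) (hx : K.d n (n + 1) x = 0) :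
    ∃ z : K.cycles n, K.iCycles n z = x := by
  have hx' : (K.sc n).g x = 0 := by
    have : (K.d n ((ComplexShape.up ℕ).next n)) x = 0 := by
      rw [CochainComplex.next]; exact hx
    exact this
  refine ⟨(K.sc n).moduleCatCyclesIso.inv ⟨x, hx'⟩, ?_⟩
  exact ConcreteCategory.congr_hom (K.sc n).moduleCatCyclesIso_inv_iCycles ⟨x, hx'⟩

theorem d_iCycles_apply {n m : ℕ} (z : K.cycles n) : K.d n m (K.iCycles n z) = 0 :=
  ConcreteCategory.congr_hom (K.iCycles_d n m) z

theorem homologyπ_eq_zero_iff {n : ℕ} (z : K.cycles n) :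
    K.homologyπ n z = 0 ↔
      ∃ y : K.X ((ComplexShape.up ℕ).prev n), K.d _ n y = K.iCycles n z := by
  constructor
  · intro h
    have hex : (ShortComplex.mk (K.sc n).toCycles (K.sc n).homologyπ (by simp)).Exact :=
      ShortComplex.exact_of_g_is_cokernel _ (K.sc n).homologyIsCokernel
    obtain ⟨y, hy⟩ := (ShortComplex.moduleCat_exact_iff _).1 hex z h
    refine ⟨y, ?_⟩
    rw [← show (K.sc n).toCycles y = z from hy]
    exact (ConcreteCategory.congr_hom (K.sc n).toCycles_i y).symm
  · rintro ⟨y, hy⟩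
    have hz : z = K.toCycles _ n y := by
      apply (ModuleCat.mono_iff_injective (K.iCycles n)).1 inferInstance
      rw [← hy]
      exact (ConcreteCategory.congr_hom (K.toCycles_i _ n) y).symm
    rw [hz]
    exact ConcreteCategory.congr_hom (K.toCycles_comp_homologyπ _ n) y

variable {K L}

theorem homologyMap_homologyπ_apply (f : K ⟶ L) {n : ℕ} (z : K.cycles n) :
    HomologicalComplex.homologyMap f n (K.homologyπ n z) =
      L.homologyπ n (HomologicalComplex.cyclesMap f n z) :=
  ConcreteCategory.congr_hom (HomologicalComplex.homologyπ_naturality f n) z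

theorem iCycles_cyclesMap_apply (f : K ⟶ L) {n : ℕ} (z : K.cycles n) :
    L.iCycles n (HomologicalComplex.cyclesMap f n z) = f.f n (K.iCycles n z) :=
  ConcreteCategory.congr_hom (HomologicalComplex.cyclesMap_i f n) z

theorem hom_d_apply (f : K ⟶ L) (m n : ℕ) (x : K.X m) :
    L.d m n (f.f m x) = f.f n (K.d m n x) :=
  ConcreteCategory.congr_hom (f.comm m n) x

theorem d_d_apply (l m n : ℕ) (x : K.X l) : K.d m n (K.d l m x) = 0 :=
  ConcreteCategory.congr_hom (K.d_comp_d l m n) x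

theorem homologyπ_surjective (n : ℕ) : Function.Surjective (K.homologyπ n) :=
  (ModuleCat.epi_iff_surjective _).1 inferInstance

/-- The relative complex `L / K` of an inclusion of complexes is acyclic in degree `n`. -/
def IsRelativelyAcyclic (f : K ⟶ L) (n : ℕ) : Prop :=
  ∀ (u : L.X n) (v : K.X (n + 1)), L.d n (n + 1) u = f.f (n + 1) v →
    ∃ (y : L.X ((ComplexShape.up ℕ).prev n)) (w : K.X n), u = L.d _ n y + f.f n w

/-- This is the long exact sequence by hand: injectivity in degree `n + 1` makes `v` a coboundary in
`K`, and after subtracting its primitive from `u`, surjectivity in degree `n` treats the remaining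
cocycle. -/
theorem isRelativelyAcyclic_of_isIso (f : K ⟶ L) (hf : ∀ n, Function.Injective (f.f n))
    (h : ∀ i, IsIso (HomologicalComplex.homologyMap f i)) (n : ℕ) : IsRelativelyAcyclic f n := by
  intro u v huv
  have hv : K.d (n + 1) (n + 2) v = 0 := by
    apply hf
    rw [← hom_d_apply, ← huv, d_d_apply, map_zero]
  obtain ⟨z, rfl⟩ := exists_cycle_of_d_eq_zero K v hv
  have hz : K.homologyπ (n + 1) z = 0 := by
    apply (ConcreteCategory.bijective_of_isIso (HomologicalComplex.homologyMap f (n + 1))).1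
    rw [homologyMap_homologyπ_apply, map_zero, homologyπ_eq_zero_iff]
    rw [CochainComplex.prev_nat_succ]
    exact ⟨u, by rw [iCycles_cyclesMap_apply, huv]⟩
  rw [homologyπ_eq_zero_iff, CochainComplex.prev_nat_succ] at hz
  obtain ⟨v, hv'⟩ := hz
  have hc : L.d n (n + 1) (u - f.f n v) = 0 := by
    rw [map_sub, huv, hom_d_apply, hv', sub_self]
  obtain ⟨c, hc⟩ := exists_cycle_of_d_eq_zero L _ hc
  obtain ⟨b, hb⟩ := (ConcreteCategory.bijective_of_isIso
    (HomologicalComplex.homologyMap f n)).2 (L.homologyπ n c)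
  obtain ⟨b, rfl⟩ := homologyπ_surjective n b
  rw [homologyMap_homologyπ_apply] at hb
  obtain ⟨y, hy⟩ := (homologyπ_eq_zero_iff L (c - HomologicalComplex.cyclesMap f n b)).1
    (by rw [map_sub, hb, sub_self])
  refine ⟨y, v + K.iCycles n b, ?_⟩
  rw [hy, map_sub, hc, iCycles_cyclesMap_apply, map_add]
  abel

/-- Acyclicity in degree `i - 1` gives injectivity on the `i`-th cohomology; acyclicity in degree
`i` with `v = 0` gives surjectivity. -/
theorem isIso_homologyMap_of_isRelativelyAcyclic (f : K ⟶ L)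
    (hf : ∀ n, Function.Injective (f.f n)) (h : ∀ n, IsRelativelyAcyclic f n) (i : ℕ) :
    IsIso (HomologicalComplex.homologyMap f i) := by
  rw [ConcreteCategory.isIso_iff_bijective]
  constructor
  · rw [injective_iff_map_eq_zero]
    intro a ha
    obtain ⟨z, rfl⟩ := homologyπ_surjective i a
    rw [homologyMap_homologyπ_apply, homologyπ_eq_zero_iff] at ha
    rw [iCycles_cyclesMap_apply] at ha
    rw [homologyπ_eq_zero_iff]
    cases i with
    -- Here `prev 0` takes its default value `0`, and the differential from degree 0 to itself
    -- vanishes, so the cycle is zero.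
    | zero =>
      obtain ⟨u, hu⟩ := ha
      refine ⟨0, hf _ ?_⟩
      rw [← hu, map_zero, map_zero, L.shape]
      · rfl
      · simp
    | succ i =>
      rw [CochainComplex.prev_nat_succ] at ha ⊢
      obtain ⟨u, hu⟩ := ha
      obtain ⟨y, w, hy⟩ := h i u _ hu
      refine ⟨w, hf _ ?_⟩
      rw [← hu, hy, map_add, d_d_apply, zero_add, hom_d_apply]
  · intro b
    obtain ⟨z, rfl⟩ := homologyπ_surjective i b
    obtain ⟨y, w, hy⟩ := h i (L.iCycles i z) 0 (by rw [d_iCycles_apply, map_zero])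
    have hw : K.d i (i + 1) w = 0 := by
      apply hf
      rw [← hom_d_apply, eq_sub_of_add_eq' hy.symm, map_sub, d_iCycles_apply, d_d_apply, sub_zero,
        map_zero]
    obtain ⟨c, hc⟩ := exists_cycle_of_d_eq_zero K w hw
    refine ⟨K.homologyπ i c, ?_⟩
    rw [homologyMap_homologyπ_apply, ← sub_eq_zero, ← map_sub, homologyπ_eq_zero_iff]
    refine ⟨-y, ?_⟩
    rw [map_sub, iCycles_cyclesMap_apply, hc, hy, map_neg]
    abel

end Homology

/-! ### Mod p approximation of continuous functions by polynomials. -/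

section Approximation

variable {p : ℕ} [Fact p.Prime]

theorem PadicInt.toZMod_eq_zero_iff_dvd (x : ℤ_[p]) : PadicInt.toZMod x = 0 ↔ (p : ℤ_[p]) ∣ x := by
  rw [← RingHom.mem_ker, PadicInt.ker_toZMod, PadicInt.maximalIdeal_eq_span_p,
    Ideal.mem_span_singleton]

theorem PadicInt.toZMod_eq_iff_dvd_sub (x y : ℤ_[p]) :
    PadicInt.toZMod x = PadicInt.toZMod y ↔ (p : ℤ_[p]) ∣ x - y := by
  rw [← PadicInt.toZMod_eq_zero_iff_dvd, map_sub, sub_eq_zero]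

theorem PadicInt.toZModPow_eq_iff (k : ℕ) (x y : ℤ_[p]) :
    PadicInt.toZModPow k x = PadicInt.toZModPow k y ↔ ‖x - y‖ ≤ (p : ℝ) ^ (-k : ℤ) := by
  rw [PadicInt.norm_le_pow_iff_mem_span_pow, ← PadicInt.ker_toZModPow, RingHom.mem_ker, map_sub,
    sub_eq_zero]

theorem PadicInt.exists_pow_lt {ε : ℝ} (hε : 0 < ε) : ∃ k : ℕ, (p : ℝ) ^ (-k : ℤ) < ε := by
  have hp : (1 : ℝ) < p := by exact_mod_cast (Fact.out : p.Prime).one_lt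
  obtain ⟨k, hk⟩ := exists_pow_lt_of_lt_one hε (inv_lt_one_of_one_lt₀ hp)
  exact ⟨k, by rwa [zpow_neg, zpow_natCast, ← inv_pow]⟩

theorem PadicInt.continuous_toZModPow_comp (k : ℕ) (F : ZMod (p ^ k) → ℤ_[p]) :
    Continuous fun x : ℤ_[p] => F (PadicInt.toZModPow k x) := by
  have hp : (0 : ℝ) < p := by exact_mod_cast (Fact.out : p.Prime).pos
  refine Metric.continuous_iff.2 fun b ε hε => ⟨(p : ℝ) ^ (-k : ℤ), zpow_pos hp _, fun a ha => ?_⟩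
  rw [dist_eq_norm] at ha
  simpa [(PadicInt.toZModPow_eq_iff k a b).2 ha.le] using hε

/-- Binomial functions are given by rational polynomials. -/
theorem PadicInt.exists_polynomial_choose (n : ℕ) :
    ∃ P : Polynomial ℚ_[p], ∀ x : ℤ_[p], ((Ring.choose x n : ℤ_[p]) : ℚ_[p]) = P.eval (x : ℚ_[p]) := by
  refine ⟨Polynomial.C ((n.factorial : ℚ_[p])⁻¹) *
    (descPochhammer ℤ n).map (Int.castRingHom ℚ_[p]), fun x => ?_⟩
  have h := congrArg (fun y : ℤ_[p] => (y : ℚ_[p])) (Ring.descPochhammer_eq_factorial_smul_choose x n)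
  have hn : (n.factorial : ℚ_[p]) ≠ 0 := Nat.cast_ne_zero.2 n.factorial_ne_zero
  rw [Polynomial.eval_mul, Polynomial.eval_C, eq_inv_mul_iff_mul_eq₀ hn]
  simp only [nsmul_eq_mul, PadicInt.coe_mul, PadicInt.coe_natCast] at h
  rw [← h, ← Polynomial.aeval_eq_smeval, Polynomial.eval_map, Polynomial.aeval_def]
  change PadicInt.Coe.ringHom _ = _
  rw [Polynomial.hom_eval₂, RingHom.ext_int (PadicInt.Coe.ringHom.comp (algebraMap ℤ ℤ_[p])) (Int.castRingHom ℚ_[p])]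
  rfl

/-- Continuous functions of one variable are congruent mod `p` to polynomial functions. -/
theorem PadicInt.exists_polynomial_congr (f : C(ℤ_[p], ℤ_[p])) :
    ∃ (P : Polynomial ℚ_[p]) (g : ℤ_[p] → ℤ_[p]), (∀ x : ℤ_[p], (g x : ℚ_[p]) = P.eval (x : ℚ_[p])) ∧
      ∀ x, (p : ℤ_[p]) ∣ g x - f x := by
  -- The Mahler series converges in the sup norm, and distance less than 1 means congruence mod p,
  -- so a finite partial sum suffices.
  obtain ⟨s, hs⟩ := ((Metric.tendsto_nhds.1 (PadicInt.hasSum_mahler f)) 1 one_pos).exists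
  choose P hP using PadicInt.exists_polynomial_choose (p := p)
  refine ⟨∑ n ∈ s, P n * Polynomial.C (((fwdDiff (1 : ℤ_[p]))^[n] f 0 : ℤ_[p]) : ℚ_[p]),
    fun x => ∑ n ∈ s, Ring.choose x n * (fwdDiff (1 : ℤ_[p]))^[n] f 0, fun x => ?_, fun x => ?_⟩
  · simp [Polynomial.eval_finsetSum, hP, PadicInt.coe_sum]
  · rw [← PadicInt.norm_lt_one_iff_dvd]
    refine lt_of_le_of_lt ?_ hs
    rw [dist_eq_norm]
    refine le_trans (le_of_eq ?_) (ContinuousMap.norm_coe_le_norm _ x)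
    simp [ContinuousMap.sum_apply, PadicInt.mahlerTerm_apply, mahler_apply]

/-- Continuous functions of several variables are congruent mod `p` to polynomial functions. -/
theorem PadicInt.exists_mvPolynomial_congr {m : ℕ} (f : (Fin m → ℤ_[p]) → ℤ_[p])
    (hf : Continuous f) :
    ∃ (P : MvPolynomial (Fin m) ℚ_[p]) (g : (Fin m → ℤ_[p]) → ℤ_[p]),
      (∀ x, (g x : ℚ_[p]) = MvPolynomial.eval (fun i => (x i : ℚ_[p])) P) ∧
      ∀ x, (p : ℤ_[p]) ∣ g x - f x := by
  -- With ε = 1, uniform continuity says that `f` mod p depends only on the coordinates mod `p ^ k`.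
  obtain ⟨δ, hδ, hfδ⟩ := Metric.uniformContinuous_iff.1
    (CompactSpace.uniformContinuous_of_continuous hf) 1 one_pos
  obtain ⟨k, hk⟩ := PadicInt.exists_pow_lt (p := p) hδ
  choose σ hσ using ZMod.ringHom_surjective (PadicInt.toZModPow (p := p) k)
  -- Indicator functions of residue classes reduce the problem to one variable: mod p, `f` is a
  -- combination of products of the `χ b` in the separate coordinates.
  let χ (b : ZMod (p ^ k)) : C(ℤ_[p], ℤ_[p]) :=
    ⟨_, PadicInt.continuous_toZModPow_comp k fun c => if c = b then 1 else 0⟩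
  choose P g hP hg using fun b => PadicInt.exists_polynomial_congr (χ b)
  have : NeZero (p ^ k) := ⟨pow_ne_zero _ (Fact.out : p.Prime).ne_zero⟩
  refine ⟨∑ a : Fin m → ZMod (p ^ k), MvPolynomial.C (f (fun i => σ (a i)) : ℚ_[p]) *
      ∏ i, Polynomial.aeval (MvPolynomial.X i) (P (a i)),
    fun x => ∑ a : Fin m → ZMod (p ^ k), f (fun i => σ (a i)) * ∏ i, g (a i) (x i),
    fun x => ?_, fun x => ?_⟩
  · simp only [PadicInt.coe_sum, PadicInt.coe_mul, map_sum, map_mul, map_prod,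
      MvPolynomial.eval_C]
    refine Finset.sum_congr rfl fun a _ => ?_
    congr 1
    change PadicInt.Coe.ringHom _ = _
    rw [map_prod]
    refine Finset.prod_congr rfl fun i _ => ?_
    change ((g (a i) (x i) : ℤ_[p]) : ℚ_[p]) = _
    rw [hP, ← MvPolynomial.aeval_eq_eval]
    rw [← Polynomial.aeval_algHom_apply, MvPolynomial.aeval_X, Polynomial.coe_aeval_eq_eval]
  · have hg' (b : ZMod (p ^ k)) (y : ℤ_[p]) :
        PadicInt.toZMod (g b y) = if PadicInt.toZModPow k y = b then 1 else 0 := by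
      rw [(PadicInt.toZMod_eq_iff_dvd_sub _ _).2 (hg b y)]
      simp only [χ, ContinuousMap.coe_mk]
      split_ifs <;> simp
    rw [← PadicInt.toZMod_eq_iff_dvd_sub]
    simp only [map_sum, map_mul, map_prod, hg']
    rw [Finset.sum_eq_single fun i => PadicInt.toZModPow k (x i)]
    · simp only [if_true, Finset.prod_const_one, mul_one]
      rw [PadicInt.toZMod_eq_iff_dvd_sub, ← PadicInt.norm_lt_one_iff_dvd, ← dist_eq_norm]
      refine hfδ ((dist_pi_lt_iff hδ).2 fun i => ?_)
      rw [dist_eq_norm]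
      exact ((PadicInt.toZModPow_eq_iff _ _ _).1 (hσ _)).trans_lt hk
    · intro a _ ha
      obtain ⟨i, hi⟩ := Function.ne_iff.1 ha
      rw [Finset.prod_eq_zero (Finset.mem_univ i) (if_neg (Ne.symm hi)), mul_zero]
    · simp

end Approximation

/-! ### Passing from a complex to its p-adic completion by successive approximation. -/

section Completion

variable {R : Type} [CommRing R]

/-- The quotient of the complex `L` by the family `N` of submodules is acyclic. -/
def IsAcyclicModulo (L : CochainComplex (ModuleCat.{0} R) ℕ) (N : ∀ n, Submodule R (L.X n)) : Prop :=
  ∀ (n : ℕ) (u : L.X n), L.d n (n + 1) u ∈ N (n + 1) →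
    ∃ (y : L.X ((ComplexShape.up ℕ).prev n)), ∃ w ∈ N n, u = L.d _ n y + w

/-- `q`-adic series with coefficients in the subset `S` of `M` converge in `S`. -/
def HasAdicSums {M : Type} [AddCommGroup M] [Module R M] (q : R) (S : Submodule R M) : Prop :=
  ∀ w : ℕ → M, (∀ i, w i ∈ S) → ∃ s ∈ S, ∀ n, ∃ z : M,
    s = ∑ i ∈ Finset.range n, q ^ i • w i + q ^ n • z

variable {L : CochainComplex (ModuleCat.{0} R) ℕ} {N D : ∀ n, Submodule R (L.X n)}

/-- One step of the `q`-adic approximation. -/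
theorem IsAcyclicModulo.exists_approximation (hN : IsAcyclicModulo L N) (q : R)
    (dN : ∀ n, ∀ u ∈ N n, L.d n (n + 1) u ∈ N (n + 1))
    (hND : ∀ n, N n ≤ D n)
    (hNq : ∀ n, ∀ u : L.X n, q • u ∈ N n → u ∈ N n)
    (hDq : ∀ n, ∀ u : L.X n, q • u ∈ D n → u ∈ D n)
    (hD : ∀ n, ∀ w ∈ D n, ∃ v ∈ N n, ∃ z : L.X n, w = v + q • z)
    (n : ℕ) (u : L.X n) (hu : L.d n (n + 1) u ∈ D (n + 1)) :
    ∃ (y : L.X ((ComplexShape.up ℕ).prev n)) (w z : L.X n), w ∈ D n ∧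
      L.d n (n + 1) z ∈ D (n + 1) ∧ u = L.d _ n y + w + q • z := by
  -- Acyclicity modulo `N` is used twice: on the error `v'`, to change `u` by a multiple of `q` so
  -- that its differential lies in `N`, and then on the changed cochain.
  obtain ⟨v, hv, v', huv⟩ := hD _ _ hu
  have hdv' : L.d (n + 1) (n + 2) v' ∈ N (n + 2) := by
    apply hNq
    have h := d_d_apply (K := L) n (n + 1) (n + 2) u
    rw [huv, map_add, map_smul] at h
    rw [eq_neg_of_add_eq_zero_right h]
    exact (N _).neg_mem (dN _ _ hv)
  have hz := hN _ v' hdv'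
  rw [CochainComplex.prev_nat_succ] at hz
  obtain ⟨z, v'', hv'', hz⟩ := hz
  have hdu : L.d n (n + 1) (u - q • z) = v + q • v'' := by
    rw [map_sub, map_smul, huv, hz, smul_add]
    abel
  obtain ⟨y, w, hw, hy⟩ := hN _ (u - q • z)
    (by rw [hdu]; exact (N _).add_mem hv ((N _).smul_mem _ hv''))
  refine ⟨y, w, z, hND _ hw, hDq _ _ ?_, by rw [← hy]; abel⟩
  -- Saturation of `D` lets `q` be cancelled here, so `z` satisfies the same hypothesis as `u` and
  -- the step can be repeated.
  have h : q • L.d n (n + 1) z = L.d n (n + 1) u - L.d n (n + 1) (u - q • z) := by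
    rw [map_sub, map_smul]
    abel
  rw [h, hdu]
  exact (D _).sub_mem hu (hND _ ((N _).add_mem hv ((N _).smul_mem _ hv'')))

/-- If `D` is a `q`-adic completion of `N` inside a `q`-adically complete complex `L` and
`L / N` is acyclic, then so is `L / D`. -/
theorem IsAcyclicModulo.of_completion (hN : IsAcyclicModulo L N) (q : R)
    (dN : ∀ n, ∀ u ∈ N n, L.d n (n + 1) u ∈ N (n + 1))
    (hND : ∀ n, N n ≤ D n)
    (hNq : ∀ n, ∀ u : L.X n, q • u ∈ N n → u ∈ N n)
    (hDq : ∀ n, ∀ u : L.X n, q • u ∈ D n → u ∈ D n)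
    (hD : ∀ n, ∀ w ∈ D n, ∃ v ∈ N n, ∃ z : L.X n, w = v + q • z)
    (hDs : ∀ n, HasAdicSums q (D n)) (hLs : ∀ n, HasAdicSums q (⊤ : Submodule R (L.X n)))
    (hsep : ∀ (n) (x : L.X n), (∀ k : ℕ, ∃ z : L.X n, x = q ^ k • z) → x = 0) :
    IsAcyclicModulo L D := by
  intro n u hu
  choose! y w z hw hz hstep using hN.exists_approximation q dN hND hNq hDq hD n
  let U : ℕ → L.X n := fun i => z^[i] u
  have hU (i : ℕ) : L.d n (n + 1) (U i) ∈ D (n + 1) := by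
    induction i with
    | zero => exact hu
    | succ i ih =>
      simp only [U, Function.iterate_succ_apply']
      exact hz _ ih
  have hsum (k : ℕ) : u = ∑ i ∈ Finset.range k, q ^ i • (L.d _ n (y (U i)) + w (U i)) +
      q ^ k • U k := by
    induction k with
    | zero => simp [U]
    | succ k ih =>
      conv_lhs => rw [ih, hstep (U k) (hU k)]
      rw [Finset.sum_range_succ, smul_add, smul_smul, ← pow_succ, add_assoc]
      simp only [U, Function.iterate_succ_apply']
  obtain ⟨Y, -, hY⟩ := hLs _ (fun i => y (U i)) fun _ => Submodule.mem_top
  obtain ⟨W, hW, hW'⟩ := hDs n (fun i => w (U i)) fun i => hw _ (hU i)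
  refine ⟨Y, W, hW, ?_⟩
  -- No continuity of the differential is needed: the difference of the two sides is divisible by
  -- every power of `q`.
  rw [← sub_eq_zero]
  refine hsep n _ fun k => ?_
  obtain ⟨a, ha⟩ := hY k
  obtain ⟨b, hb⟩ := hW' k
  refine ⟨U k - L.d _ n a - b, ?_⟩
  have h := hsum k
  simp only [smul_add, Finset.sum_add_distrib] at h
  rw [ha, hb]
  conv_lhs => rw [h]
  simp only [map_add, map_sum, map_smul, smul_sub]
  abel

theorem isRelativelyAcyclic_iff_isAcyclicModulo {K : CochainComplex (ModuleCat.{0} R) ℕ}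
    (f : K ⟶ L) : (∀ n, IsRelativelyAcyclic f n) ↔
      IsAcyclicModulo L fun n => LinearMap.range (f.f n).hom := by
  constructor
  · rintro h n u ⟨v, hv⟩
    obtain ⟨y, w, hy⟩ := h n u v hv.symm
    exact ⟨y, _, ⟨w, rfl⟩, hy⟩
  · rintro h n u v hv
    obtain ⟨y, _, ⟨w, rfl⟩, hy⟩ := h n u ⟨v, hv.symm⟩
    exact ⟨y, w, hy⟩

end Completion

/-! ### Saturation, density and completeness of the function classes. -/

section Functions

variable {p : ℕ} [Fact p.Prime] {M : PadicNum p}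

theorem numericalFunctions_le_continuousFunctions :
    (numericalFunctions p).functions M ≤ (continuousFunctions p).functions M := by
  intro u hu
  obtain ⟨m, ⟨e⟩⟩ := exists_coordinates (p := p) (M := M.carrier)
  obtain ⟨P, hP⟩ := (isNumericalFunction_iff e u).1 hu
  exact continuous_of_polynomial e u P hP

/-- The defining polynomials have coefficients in ℚ_p, so they may be divided by p. -/
theorem mem_numericalFunctions_of_smul_mem (u : M.carrier → ℤ_[p])
    (hu : (p : ℤ_[p]) • u ∈ (numericalFunctions p).functions M) :
    u ∈ (numericalFunctions p).functions M := by
  obtain ⟨m, ⟨e⟩⟩ := exists_coordinates (p := p) (M := M.carrier)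
  obtain ⟨P, hP⟩ := (isNumericalFunction_iff e _).1 hu
  have hp : (p : ℚ_[p]) ≠ 0 := Nat.cast_ne_zero.2 (Fact.out : p.Prime).ne_zero
  refine (isNumericalFunction_iff e _).2 ⟨MvPolynomial.C ((p : ℚ_[p])⁻¹) * P, fun x => ?_⟩
  rw [map_mul, MvPolynomial.eval_C, eq_inv_mul_iff_mul_eq₀ hp, ← hP]
  simp

theorem mem_continuousFunctions_of_smul_mem (u : M.carrier → ℤ_[p])
    (hu : (p : ℤ_[p]) • u ∈ (continuousFunctions p).functions M) :
    u ∈ (continuousFunctions p).functions M := by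
  let := padicTopology p M.carrier
  have hp : (0 : ℝ) < ‖(p : ℤ_[p])‖ :=
    norm_pos_iff.2 (Nat.cast_ne_zero.2 (Fact.out : p.Prime).ne_zero)
  have hu : Continuous ((p : ℤ_[p]) • u) := hu
  change Continuous u
  refine continuous_iff_continuousAt.2 fun x => Metric.tendsto_nhds.2 fun ε hε => ?_
  filter_upwards [Metric.tendsto_nhds.1 (hu.tendsto x) _ (mul_pos hp hε)] with y hy
  rw [dist_eq_norm, Pi.smul_apply, Pi.smul_apply, ← smul_sub, norm_smul] at hy
  rw [dist_eq_norm]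
  exact lt_of_mul_lt_mul_left hy hp.le

theorem continuous_symm_padicTopology {m : ℕ} (e : M.carrier ≃ₗ[ℤ_[p]] (Fin m → ℤ_[p])) :
    @Continuous _ _ _ (padicTopology p M.carrier) e.symm := by
  let := padicTopology p M.carrier
  refine continuous_iff_continuousAt.2 fun x =>
    (nhds_padicTopology (e.symm x)).tendsto_right_iff.2 fun k _ => ?_
  have hp : (0 : ℝ) < p := by exact_mod_cast (Fact.out : p.Prime).pos
  filter_upwards [Metric.ball_mem_nhds x (zpow_pos hp (-k : ℤ))] with y hy
  have key (j : Fin m) : ∃ w : ℤ_[p], w * (p : ℤ_[p]) ^ k = y j - x j := by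
    rw [← Ideal.mem_span_singleton', ← PadicInt.norm_le_pow_iff_mem_span_pow, ← dist_eq_norm]
    exact ((dist_le_pi_dist y x j).trans_lt hy).le
  choose w hw using key
  have hyx : e.symm y - e.symm x = (p : ℤ_[p]) ^ k • e.symm w := by
    rw [← map_sub, ← map_smul]
    congr 1
    ext j
    simp [← hw j, mul_comm]
  change e.symm y - e.symm x ∈ _
  rw [hyx]
  exact Submodule.smul_mem_smul
    (Ideal.pow_mem_pow (Ideal.mem_span_singleton_self _) k) Submodule.mem_top

/-- Continuous functions are congruent mod `p` to numerical functions. -/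
theorem exists_numericalFunction_congr (u : M.carrier → ℤ_[p])
    (hu : u ∈ (continuousFunctions p).functions M) :
    ∃ v ∈ (numericalFunctions p).functions M, ∃ z : M.carrier → ℤ_[p],
      u = v + (p : ℤ_[p]) • z := by
  obtain ⟨m, ⟨e⟩⟩ := exists_coordinates (p := p) (M := M.carrier)
  have hc : Continuous fun x => u (e.symm x) := by
    let := padicTopology p M.carrier
    exact Continuous.comp (show Continuous u from hu) (continuous_symm_padicTopology e)
  obtain ⟨P, g, hP, hg⟩ := PadicInt.exists_mvPolynomial_congr _ hc
  choose z hz using hg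
  refine ⟨fun x => g (e x), (isNumericalFunction_iff e _).2 ⟨P, fun x => hP _⟩,
    fun x => - z (e x), ?_⟩
  ext x
  have := hz (e x)
  simp only [LinearEquiv.symm_apply_apply] at this
  simp only [Pi.add_apply, Pi.smul_apply, smul_eq_mul, mul_neg, ← this]
  ring

theorem PadicInt.summable_pow_mul (w : ℕ → ℤ_[p]) : Summable fun i => (p : ℤ_[p]) ^ i * w i := by
  refine Summable.of_norm_bounded
    (summable_geometric_of_lt_one (norm_nonneg (p : ℤ_[p])) ?_) fun i => ?_
  · exact ((PadicInt.norm_lt_one_iff_dvd _).2 dvd_rfl)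
  · rw [norm_mul, norm_pow]
    exact mul_le_of_le_one_right (by positivity) (PadicInt.norm_le_one _)

theorem tsum_pow_smul_eq (w : ℕ → M.carrier → ℤ_[p]) (n : ℕ) :
    (fun x => ∑' i, (p : ℤ_[p]) ^ i * w i x) = ∑ i ∈ Finset.range n, (p : ℤ_[p]) ^ i • w i +
      (p : ℤ_[p]) ^ n • fun x => ∑' i, (p : ℤ_[p]) ^ i * w (i + n) x := by
  ext x
  rw [← (PadicInt.summable_pow_mul fun i => w i x).sum_add_tsum_nat_add n]
  simp only [Pi.add_apply, Finset.sum_apply, Pi.smul_apply, smul_eq_mul]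
  rw [← (PadicInt.summable_pow_mul fun i => w (i + n) x).tsum_mul_left]
  congr 1
  refine tsum_congr fun i => ?_
  ring

theorem hasAdicSums_allFunctions :
    HasAdicSums (p : ℤ_[p]) (⊤ : Submodule ℤ_[p] (M.carrier → ℤ_[p])) :=
  fun w _ => ⟨_, Submodule.mem_top, fun n => ⟨_, tsum_pow_smul_eq w n⟩⟩

theorem hasAdicSums_continuousFunctions :
    HasAdicSums (p : ℤ_[p]) ((continuousFunctions p).functions M) := by
  refine fun w hw => ⟨_, ?_, fun n => ⟨_, tsum_pow_smul_eq w n⟩⟩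
  let := padicTopology p M.carrier
  refine continuous_tsum (u := fun i => ‖(p : ℤ_[p])‖ ^ i)
    (fun i => continuous_const.mul (show Continuous (w i) from hw i))
    (summable_geometric_of_lt_one (norm_nonneg _) ((PadicInt.norm_lt_one_iff_dvd _).2 dvd_rfl)) fun i x => ?_
  rw [norm_mul, norm_pow]
  exact mul_le_of_le_one_right (by positivity) (PadicInt.norm_le_one _)

theorem PadicInt.eq_zero_of_forall_pow_dvd (x : ℤ_[p]) (h : ∀ k : ℕ, (p : ℤ_[p]) ^ k ∣ x) :
    x = 0 := by
  rw [← PadicInt.ext_of_toZModPow]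
  intro k
  rw [map_zero, ← RingHom.mem_ker, PadicInt.ker_toZModPow, Ideal.mem_span_singleton]
  exact h k

end Functions

/-! ### Continuous cochains compute ordinary cohomology. -/

section Cohomology

variable {p : ℕ} [Fact p.Prime] (S : FunctionClass p) (X : SimplicialObject (PadicNum p))

theorem cochainsInclusion_injective (n : ℕ) :
    Function.Injective ((cochainsInclusion S X).f n) :=
  Submodule.inclusion_injective le_top

theorem mem_range_cochainsInclusion {n : ℕ} (u : (cochains (allFunctions p) X).X n) :
    u ∈ LinearMap.range ((cochainsInclusion S X).f n).hom ↔
      (show (allFunctions p).functions (X.obj (op (SimplexCategory.mk n))) from u).1 ∈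
        S.functions (X.obj (op (SimplexCategory.mk n))) := by
  constructor
  · rintro ⟨v, rfl⟩
    exact v.2
  · intro h
    exact ⟨⟨_, h⟩, rfl⟩

theorem isIso_toOrdinaryCohomology_iff :
    (∀ i, IsIso (toOrdinaryCohomology S X i)) ↔
      IsAcyclicModulo (cochains (allFunctions p) X) fun n =>
        LinearMap.range ((cochainsInclusion S X).f n).hom := by
  rw [← isRelativelyAcyclic_iff_isAcyclicModulo]
  exact ⟨isRelativelyAcyclic_of_isIso _ (cochainsInclusion_injective S X),
    isIso_homologyMap_of_isRelativelyAcyclic _ (cochainsInclusion_injective S X)⟩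

theorem d_mem_range_cochainsInclusion (n : ℕ) (u : (cochains (allFunctions p) X).X n)
    (hu : u ∈ LinearMap.range ((cochainsInclusion S X).f n).hom) :
    (cochains (allFunctions p) X).d n (n + 1) u ∈
      LinearMap.range ((cochainsInclusion S X).f (n + 1)).hom := by
  obtain ⟨v, rfl⟩ := hu
  exact ⟨_, (hom_d_apply (cochainsInclusion S X) n (n + 1) v).symm⟩

theorem hasAdicSums_range_cochainsInclusion (n : ℕ) (q : ℤ_[p])
    (h : HasAdicSums q (S.functions (X.obj (op (SimplexCategory.mk n))))) :
    HasAdicSums q (LinearMap.range ((cochainsInclusion S X).f n).hom) := by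
  intro w hw
  obtain ⟨s, hs, hs'⟩ := h (fun i =>
    (show (allFunctions p).functions (X.obj (op (SimplexCategory.mk n))) from w i).1)
    fun i => (mem_range_cochainsInclusion S X _).1 (hw i)
  refine ⟨⟨s, Submodule.mem_top⟩, (mem_range_cochainsInclusion S X _).2 hs, fun k => ?_⟩
  obtain ⟨z, hz⟩ := hs' k
  refine ⟨⟨z, Submodule.mem_top⟩, Subtype.ext ?_⟩
  rw [hz]
  refine Eq.symm ?_
  exact (congrArg (· + q ^ k • z) (map_sum (Submodule.subtype _) _ _)).trans rfl

/-- If the cohomology of `X` can be computed using numerical cochains, then it can be computed using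
continuous cochains. -/
theorem isIso_toOrdinaryCohomology_continuousFunctions
    (h : ∀ i, IsIso (toOrdinaryCohomology (numericalFunctions p) X i)) (i : ℕ) :
    IsIso (toOrdinaryCohomology (continuousFunctions p) X i) := by
  rw [isIso_toOrdinaryCohomology_iff] at h
  refine (isIso_toOrdinaryCohomology_iff _ X).2 (h.of_completion (p : ℤ_[p])
    (d_mem_range_cochainsInclusion _ X) ?_ ?_ ?_ ?_ ?_ ?_ ?_) i
  · intro n u hu
    rw [mem_range_cochainsInclusion] at hu ⊢
    exact numericalFunctions_le_continuousFunctions hu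
  · intro n u hu
    rw [mem_range_cochainsInclusion] at hu ⊢
    exact mem_numericalFunctions_of_smul_mem _ hu
  · intro n u hu
    rw [mem_range_cochainsInclusion] at hu ⊢
    exact mem_continuousFunctions_of_smul_mem _ hu
  · intro n u hu
    rw [mem_range_cochainsInclusion] at hu
    obtain ⟨v, hv, z, hz⟩ := exists_numericalFunction_congr _ hu
    exact ⟨⟨v, Submodule.mem_top⟩, (mem_range_cochainsInclusion _ X _).2 hv,
      ⟨z, Submodule.mem_top⟩, Subtype.ext hz⟩
  · exact fun n => hasAdicSums_range_cochainsInclusion _ X n _ hasAdicSums_continuousFunctions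
  · intro n w hw
    obtain ⟨s, -, hs⟩ := hasAdicSums_range_cochainsInclusion (allFunctions p) X n _
      hasAdicSums_allFunctions w fun i => ⟨w i, rfl⟩
    exact ⟨s, Submodule.mem_top, hs⟩
  · intro n x hx
    refine Subtype.ext (funext fun a => PadicInt.eq_zero_of_forall_pow_dvd _ fun k => ?_)
    obtain ⟨z, hz⟩ := hx k
    exact ⟨z.1 a, congrFun (congrArg Subtype.val hz) a⟩

end Cohomology

/-! ### Unitriangular families of integer-valued functions. -/

section Triangular

variable {I A : Type} {e : I → A → ℤ} {a : I → A}

theorem mem_span_range_iff_forall_eq_sum (F : A → ℤ) :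
    F ∈ Submodule.span ℤ (Set.range e) ↔ ∃ c : I →₀ ℤ, ∀ x, F x = c.sum fun i b => b * e i x := by
  rw [Finsupp.mem_span_range_iff_exists_finsupp]
  refine exists_congr fun c => ?_
  rw [eq_comm, funext_iff]
  simp [Finsupp.sum, Finset.sum_apply]

variable [PartialOrder I] [WellFoundedLT I]

/-- If all values of an integral combination of a unitriangular family of functions are divisible
by `m`, then so are the coefficients. -/
theorem dvd_coeff_of_triangular (h1 : ∀ i, e i (a i) = 1) (h0 : ∀ i j, ¬ j ≤ i → e j (a i) = 0)
    (c : I →₀ ℤ) (m : ℤ) (h : ∀ x, m ∣ c.sum fun i b => b * e i x) (i : I) : m ∣ c i := by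
  classical
  induction i using WellFoundedLT.induction with
  | ind i ih =>
    by_cases hi : i ∈ c.support
    · have hs := h (a i)
      rw [Finsupp.sum, ← Finset.add_sum_erase _ _ hi, h1, mul_one] at hs
      refine (Int.dvd_iff_dvd_of_dvd_add hs).2 (Finset.dvd_sum fun j hj => ?_)
      by_cases hji : j ≤ i
      · exact Dvd.dvd.mul_right (ih j (lt_of_le_of_ne hji (Finset.ne_of_mem_erase hj))) _
      · rw [h0 i j hji, mul_zero]
        exact dvd_zero m
    · rw [Finsupp.notMem_support_iff.1 hi]
      exact dvd_zero m

/-- The span of a unitriangular family of functions is saturated. -/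
theorem mem_span_range_of_smul_mem (h1 : ∀ i, e i (a i) = 1) (h0 : ∀ i j, ¬ j ≤ i → e j (a i) = 0)
    {N : ℕ} (hN : N ≠ 0) (F : A → ℤ) (hF : N • F ∈ Submodule.span ℤ (Set.range e)) :
    F ∈ Submodule.span ℤ (Set.range e) := by
  rw [mem_span_range_iff_forall_eq_sum] at hF ⊢
  obtain ⟨c, hc⟩ := hF
  have hd : ∀ i, (N : ℤ) ∣ c i := dvd_coeff_of_triangular h1 h0 c N fun x =>
    ⟨F x, by rw [← hc]; simp⟩
  refine ⟨c.mapRange (fun b => b / N) (Int.zero_ediv _), fun x => ?_⟩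
  have hN' : (N : ℤ) ≠ 0 := by exact_mod_cast hN
  apply mul_left_cancel₀ hN'
  have hx := hc x
  rw [Pi.smul_apply, nsmul_eq_mul] at hx
  rw [hx, Finsupp.sum_mapRange_index (by simp), Finsupp.sum, Finsupp.sum, Finset.mul_sum]
  refine Finset.sum_congr rfl fun i _ => ?_
  rw [← mul_assoc, Int.mul_ediv_cancel' (hd i)]

end Triangular

/-- A submodule containing `1` and stable under multiplication by `U` contains the subalgebra
generated by `U`. -/
theorem adjoin_le_of_mul_mem {B : Type} [CommRing B] {U : Set B} {V : Submodule ℤ B} (h1 : 1 ∈ V)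
    (hU : ∀ u ∈ U, ∀ v ∈ V, u * v ∈ V) : ∀ b ∈ Algebra.adjoin ℤ U, b ∈ V := by
  intro b hb
  suffices h : ∀ v ∈ V, b * v ∈ V by simpa using h 1 h1
  induction hb using Algebra.adjoin_induction with
  | mem u hu => exact hU u hu
  | algebraMap r =>
    intro v hv
    rw [← Algebra.smul_def]
    exact V.smul_mem _ hv
  | add x y _ _ hx hy =>
    intro v hv
    rw [add_mul]
    exact V.add_mem (hx v hv) (hy v hv)
  | mul x y _ _ hx hy =>
    intro v hv
    rw [mul_assoc]
    exact hx _ (hy v hv)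

/-! ### Existence of the integer coefficients in the binomial identities. -/

section Coefficients

/-- Used to show that the span of the binomial functions is stable under multiplication by the
variable. -/
theorem Ring.mul_choose_eq (x : ℤ) (k : ℕ) :
    x * Ring.choose x k = (k + 1) * Ring.choose x (k + 1) + k * Ring.choose x k := by
  have h (n : ℕ) := Ring.descPochhammer_eq_factorial_smul_choose x n
  simp only [← Polynomial.eval_eq_smeval, nsmul_eq_mul] at h
  have hk := h (k + 1)
  rw [descPochhammer_succ_right, Polynomial.eval_mul, h k, Nat.factorial_succ] at hk
  have hf : (k.factorial : ℤ) ≠ 0 := by exact_mod_cast k.factorial_ne_zero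
  apply mul_left_cancel₀ hf
  simp at hk
  linear_combination hk

theorem Int.choose_eq_zero_of_lt {n k : ℕ} (h : n < k) : Ring.choose (n : ℤ) k = 0 := by
  rw [Ring.choose_natCast, Nat.choose_eq_zero_of_lt h, Nat.cast_zero]

theorem Int.choose_self (n : ℕ) : Ring.choose (n : ℤ) n = 1 := by
  rw [Ring.choose_natCast, Nat.choose_self, Nat.cast_one]

/-- The `n`-th binomial function of `g`, up to a factor, is an integral polynomial in `g`. -/
theorem factorial_smul_choose_mem_adjoin {A : Type} (g : A → ℤ) (n : ℕ) :
    n.factorial • (fun x => Ring.choose (g x) n) ∈ Algebra.adjoin ℤ {g} := by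
  have h : n.factorial • (fun x => Ring.choose (g x) n) =
      Polynomial.aeval g (descPochhammer ℤ n) := by
    ext x
    change n.factorial • Ring.choose (g x) n = Pi.evalAlgHom ℤ (fun _ : A => ℤ) x
      (Polynomial.aeval g (descPochhammer ℤ n))
    rw [← Polynomial.aeval_algHom_apply, ← Ring.descPochhammer_eq_factorial_smul_choose,
      Polynomial.aeval_eq_smeval]
    rfl
  rw [h]
  exact Polynomial.aeval_mem_adjoin_singleton _ _

/-- The span of the binomial functions of one integer variable. -/
def binomialSpan : Submodule ℤ (ℤ → ℤ) :=
  Submodule.span ℤ (Set.range fun (k : ℕ) (x : ℤ) => Ring.choose x k)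

theorem binomialSpan_saturated {N : ℕ} (hN : N ≠ 0) (F : ℤ → ℤ) (hF : N • F ∈ binomialSpan) :
    F ∈ binomialSpan :=
  mem_span_range_of_smul_mem (a := fun n : ℕ => (n : ℤ)) Int.choose_self
    (fun _ _ h => Int.choose_eq_zero_of_lt (not_le.1 h)) hN F hF

theorem one_mem_binomialSpan : 1 ∈ binomialSpan :=
  Submodule.subset_span ⟨0, by ext x; simp⟩

theorem adjoin_id_le_binomialSpan : ∀ F ∈ Algebra.adjoin ℤ {(id : ℤ → ℤ)}, F ∈ binomialSpan := by
  refine adjoin_le_of_mul_mem one_mem_binomialSpan ?_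
  rintro _ rfl v hv
  induction hv using Submodule.span_induction with
  | mem v hv =>
    obtain ⟨k, rfl⟩ := hv
    have : (id * fun x : ℤ => Ring.choose x k) =
        ((k : ℤ) + 1) • (fun x : ℤ => Ring.choose x (k + 1)) +
          (k : ℤ) • fun x : ℤ => Ring.choose x k := by
      ext x
      simpa using Ring.mul_choose_eq x k
    rw [this]
    exact add_mem (Submodule.smul_mem _ _ (Submodule.subset_span ⟨_, rfl⟩))
      (Submodule.smul_mem _ _ (Submodule.subset_span ⟨_, rfl⟩))
  | zero => rw [mul_zero]; exact zero_mem _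
  | add x y _ _ hx hy => rw [mul_add]; exact add_mem hx hy
  | smul a x _ hx => rw [mul_smul_comm]; exact Submodule.smul_mem _ _ hx

/-- The function times `m! n!` is an integral polynomial in `x`, hence in the span; saturation
removes the factor. -/
theorem choose_mul_choose_mem_binomialSpan (m n : ℕ) :
    (fun x : ℤ => Ring.choose x m * Ring.choose x n) ∈ binomialSpan := by
  refine binomialSpan_saturated (mul_ne_zero m.factorial_ne_zero n.factorial_ne_zero) _
    (adjoin_id_le_binomialSpan _ ?_)
  convert mul_mem (factorial_smul_choose_mem_adjoin (id : ℤ → ℤ) m)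
    (factorial_smul_choose_mem_adjoin (id : ℤ → ℤ) n) using 1
  ext x
  simp only [Pi.smul_apply, Pi.mul_apply, nsmul_eq_mul, id_eq, Pi.natCast_apply]
  push_cast
  ring

/-- Times `n!` it is an integral polynomial in the `m`-th binomial function, and the span is stable
under multiplication by that function. -/
theorem choose_choose_mem_binomialSpan (m n : ℕ) :
    (fun x : ℤ => Ring.choose (Ring.choose x m) n) ∈ binomialSpan := by
  refine binomialSpan_saturated n.factorial_ne_zero _ (adjoin_le_of_mul_mem
    (U := {fun x : ℤ => Ring.choose x m}) one_mem_binomialSpan ?_ _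
    (factorial_smul_choose_mem_adjoin (fun x : ℤ => Ring.choose x m) n))
  rintro _ rfl v hv
  induction hv using Submodule.span_induction with
  | mem v hv =>
    obtain ⟨k, rfl⟩ := hv
    exact choose_mul_choose_mem_binomialSpan m k
  | zero => rw [mul_zero]; exact zero_mem _
  | add x y _ _ hx hy => rw [mul_add]; exact add_mem hx hy
  | smul a x _ hx => rw [mul_smul_comm]; exact Submodule.smul_mem _ _ hx

/-- The span of the products of binomial functions of two integer variables. -/
def binomialSpanTwo : Submodule ℤ (ℤ × ℤ → ℤ) :=
  Submodule.span ℤ (Set.range fun (ij : ℕ × ℕ) (x : ℤ × ℤ) =>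
    Ring.choose x.1 ij.1 * Ring.choose x.2 ij.2)

theorem mul_mem_binomialSpanTwo (f g : ℤ → ℤ) (hf : f ∈ binomialSpan) (hg : g ∈ binomialSpan) :
    (fun x : ℤ × ℤ => f x.1 * g x.2) ∈ binomialSpanTwo := by
  induction hf using Submodule.span_induction with
  | mem f hf =>
    obtain ⟨i, rfl⟩ := hf
    induction hg using Submodule.span_induction with
    | mem g hg =>
      obtain ⟨j, rfl⟩ := hg
      exact Submodule.subset_span ⟨(i, j), rfl⟩
    | zero =>
      convert zero_mem binomialSpanTwo using 1
      ext x
      simp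
    | add x y _ _ hx hy => simpa [mul_add] using! add_mem hx hy
    | smul a x _ hx => simpa [mul_left_comm] using! Submodule.smul_mem _ a hx
  | zero =>
    convert zero_mem binomialSpanTwo using 1
    ext x
    simp
  | add x y _ _ hx hy => simpa [add_mul] using! add_mem hx hy
  | smul a x _ hx => simpa [mul_assoc] using! Submodule.smul_mem _ a hx

theorem one_mem_binomialSpanTwo : 1 ∈ binomialSpanTwo :=
  Submodule.subset_span ⟨0, by ext x; simp⟩

theorem choose_mul_mem_binomialSpanTwo (n : ℕ) :
    (fun x : ℤ × ℤ => Ring.choose (x.1 * x.2) n) ∈ binomialSpanTwo := by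
  -- The same saturation argument, unitriangular at pairs of natural numbers for the product order.
  refine mem_span_range_of_smul_mem (a := fun n : ℕ × ℕ => ((n.1 : ℤ), (n.2 : ℤ)))
    (fun i => by simp only [Int.choose_self, mul_one]) ?_ n.factorial_ne_zero _
    (adjoin_le_of_mul_mem (U := {fun x : ℤ × ℤ => x.1 * x.2})
      one_mem_binomialSpanTwo ?_ _ (factorial_smul_choose_mem_adjoin _ n))
  · intro i j h
    rcases not_and_or.1 (mt Prod.le_def.2 h) with h | h <;>
      simp [Int.choose_eq_zero_of_lt (not_le.1 h)]
  · have hid (k : ℕ) : (fun x : ℤ => x * Ring.choose x k) ∈ binomialSpan := by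
      simpa using choose_mul_choose_mem_binomialSpan 1 k
    rintro _ rfl v hv
    induction hv using Submodule.span_induction with
    | mem v hv =>
      obtain ⟨k, rfl⟩ := hv
      convert mul_mem_binomialSpanTwo _ _ (hid k.1) (hid k.2) using 1
      ext x
      simp only [Pi.mul_apply]
      ring
    | zero => rw [mul_zero]; exact zero_mem _
    | add x y _ _ hx hy => rw [mul_add]; exact add_mem hx hy
    | smul a x _ hx => rw [mul_smul_comm]; exact Submodule.smul_mem _ _ hx

end Coefficients

/-! ### The numerical rings ℤ and ℤ_p, and the structure of free numerical rings. -/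

section NumericalRings

noncomputable instance : NumericalRing ℤ where
  binom n x := Ring.choose x n
  binom_index_zero := Ring.choose_zero_right
  binom_zero n hn := Ring.choose_zero_pos ℤ hn
  binom_one n hn := by exact_mod_cast Int.choose_eq_zero_of_lt (n := 1) hn
  binom_index_one := Ring.choose_one_right
  binom_add n r s := Ring.add_choose_eq n (Commute.all r s)
  binom_mul_binom _ _ _ h r := by simpa using h r
  binom_mul _ _ h r s := by simpa using h r s
  binom_binom _ _ _ h r := by simpa using h r

theorem PadicInt.choose_intCast (p : ℕ) [Fact p.Prime] (x : ℤ) (n : ℕ) :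
    Ring.choose (x : ℤ_[p]) n = (Ring.choose x n : ℤ) :=
  (Ring.map_choose (Int.castRingHom ℤ_[p]) x n).symm

/-- The identities with coefficients extend from the dense subset ℤ because binomial functions are
continuous on ℤ_p. -/
noncomputable instance (p : ℕ) [Fact p.Prime] : NumericalRing ℤ_[p] where
  binom n x := Ring.choose x n
  binom_index_zero := Ring.choose_zero_right
  binom_zero n hn := Ring.choose_zero_pos ℤ_[p] hn
  binom_one n hn := by
    have := PadicInt.choose_intCast p 1 n
    rw [show Ring.choose (1 : ℤ) n = 0 by exact_mod_cast Int.choose_eq_zero_of_lt (n := 1) hn]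
      at this
    simpa using this
  binom_index_one := Ring.choose_one_right
  binom_add n r s := Ring.add_choose_eq n (Commute.all r s)
  binom_mul_binom m n c h r := by
    refine PadicInt.denseRange_intCast.induction_on r
      (isClosed_eq (by fun_prop) (by unfold Finsupp.sum; fun_prop)) fun x => ?_
    simp only [PadicInt.choose_intCast, ← Int.cast_mul, h, Finsupp.sum, Int.cast_sum]
  binom_mul n c h r s := by
    refine PadicInt.denseRange_intCast.induction_on₂ (p := fun r s : ℤ_[p] => Ring.choose (r * s) n =
      c.sum fun ij a => (a : ℤ_[p]) * (Ring.choose r ij.1 * Ring.choose s ij.2))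
      (isClosed_eq ?_ ?_) (fun x y => ?_) r s
    · exact (PadicInt.continuous_choose n).comp (by fun_prop)
    · unfold Finsupp.sum
      refine continuous_finsetSum _ fun ij _ => continuous_const.mul
        (((PadicInt.continuous_choose _).comp continuous_fst).mul
        ((PadicInt.continuous_choose _).comp continuous_snd))
    · simp only [PadicInt.choose_intCast, ← Int.cast_mul, h, Finsupp.sum, Int.cast_sum]
  binom_binom m n c h r := by
    refine PadicInt.denseRange_intCast.induction_on r
      (isClosed_eq ((PadicInt.continuous_choose n).comp (PadicInt.continuous_choose m))
        (by unfold Finsupp.sum; fun_prop)) fun x => ?_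
    simp only [PadicInt.choose_intCast, ← Int.cast_mul, h, Finsupp.sum, Int.cast_sum]

theorem isNumericalHom_intCast (p : ℕ) [Fact p.Prime] : IsNumericalHom (Int.castRingHom ℤ_[p]) :=
  fun n x => (PadicInt.choose_intCast p x n).symm

theorem IsNumericalHom.comp {R S T : Type} [CommRing R] [CommRing S] [CommRing T] [NumericalRing R]
    [NumericalRing S] [NumericalRing T] {g : S →+* T} {f : R →+* S} (hg : IsNumericalHom g)
    (hf : IsNumericalHom f) : IsNumericalHom (g.comp f) := fun n r => by
  rw [RingHom.comp_apply, hf, hg, RingHom.comp_apply]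

variable {R : Type} [CommRing R] [NumericalRing R]

open NumericalRing

/-- A subring closed under the binomial operations is a numerical ring. -/
@[reducible] def NumericalRing.ofSubring (A : Subring R) (hA : ∀ r ∈ A, ∀ n, binom n r ∈ A) :
    NumericalRing A where
  binom n r := ⟨binom n r.1, hA r.1 r.2 n⟩
  binom_index_zero r := Subtype.ext (binom_index_zero r.1)
  binom_zero n hn := Subtype.ext (binom_zero n hn)
  binom_one n hn := Subtype.ext (binom_one n hn)
  binom_index_one r := Subtype.ext (binom_index_one r.1)
  binom_add n r s := Subtype.ext (by simpa using binom_add n r.1 s.1)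
  binom_mul_binom m n c h r := Subtype.ext (by
    simpa [Finsupp.sum] using binom_mul_binom m n c h r.1)
  binom_mul n c h r s := Subtype.ext (by simpa [Finsupp.sum] using binom_mul n c h r.1 s.1)
  binom_binom m n c h r := Subtype.ext (by simpa [Finsupp.sum] using binom_binom m n c h r.1)

/-- The product and composition axioms of a numerical ring say something only once coefficients are
exhibited; this and the next two lemmas supply them. -/
theorem exists_choose_mul_choose_eq_sum (m n : ℕ) : ∃ c : ℕ →₀ ℤ, ∀ x : ℤ,
    Ring.choose x m * Ring.choose x n = c.sum fun k a => a * Ring.choose x k :=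
  (mem_span_range_iff_forall_eq_sum _).1 (choose_mul_choose_mem_binomialSpan m n)

theorem exists_choose_choose_eq_sum (m n : ℕ) : ∃ c : ℕ →₀ ℤ, ∀ x : ℤ,
    Ring.choose (Ring.choose x m) n = c.sum fun k a => a * Ring.choose x k :=
  (mem_span_range_iff_forall_eq_sum _).1 (choose_choose_mem_binomialSpan m n)

theorem exists_choose_mul_eq_sum (n : ℕ) : ∃ c : ℕ × ℕ →₀ ℤ, ∀ x y : ℤ,
    Ring.choose (x * y) n = c.sum fun ij a => a * (Ring.choose x ij.1 * Ring.choose y ij.2) := by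
  obtain ⟨c, hc⟩ := (mem_span_range_iff_forall_eq_sum _).1 (choose_mul_mem_binomialSpanTwo n)
  exact ⟨c, fun x y => hc (x, y)⟩

/-- Elements all of whose binomials lie in the subring `A`. -/
def NumericalRing.binomSubring (A : Subring R) : Subring R where
  carrier := {r | ∀ n, binom n r ∈ A}
  zero_mem' n := by
    rcases n.eq_zero_or_pos with rfl | hn
    · rw [binom_index_zero]; exact A.one_mem
    · rw [binom_zero n hn]; exact A.zero_mem
  one_mem' n := by
    match n with
    | 0 => rw [binom_index_zero]; exact A.one_mem
    | 1 => rw [binom_index_one]; exact A.one_mem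
    | n + 2 => rw [binom_one _ (by omega)]; exact A.zero_mem
  add_mem' {r s} hr hs n := by
    rw [binom_add]
    exact A.sum_mem fun ij _ => A.mul_mem (hr _) (hs _)
  mul_mem' {r s} hr hs n := by
    obtain ⟨c, hc⟩ := exists_choose_mul_eq_sum n
    rw [binom_mul n c hc]
    exact A.sum_mem fun ij _ => A.mul_mem (intCast_mem A _) (A.mul_mem (hr _) (hs _))
  neg_mem' {r} hr n := by
    induction n using Nat.strong_induction_on with
    | _ n ih =>
      -- The addition formula for `r + (-r) = 0` is solved for its term `(0, n)`; every other term
      -- involves a binomial of `-r` of index below `n`.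
      have h := binom_add n r (-r)
      have h0 : (0, n) ∈ Finset.HasAntidiagonal.antidiagonal n := by simp
      rw [add_neg_cancel, ← Finset.add_sum_erase _ _ h0, binom_index_zero, one_mul] at h
      rw [eq_sub_of_add_eq h.symm]
      refine A.sub_mem ?_ (A.sum_mem fun ij hij => A.mul_mem (hr _) (ih _ ?_))
      · rcases n.eq_zero_or_pos with rfl | hn
        · rw [binom_index_zero]; exact A.one_mem
        · rw [binom_zero n hn]; exact A.zero_mem
      · obtain ⟨hne, hij⟩ := Finset.mem_erase.1 hij
        rw [Finset.HasAntidiagonal.mem_antidiagonal] at hij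
        have : ij.1 ≠ 0 := fun h => hne (Prod.ext h (by simp; omega))
        omega

theorem NumericalRing.binom_mem_binomSubring {A : Subring R} {r : R} (h : ∀ n, binom n r ∈ A)
    (m : ℕ) : binom m r ∈ binomSubring A := fun n => by
  obtain ⟨c, hc⟩ := exists_choose_choose_eq_sum m n
  rw [binom_binom m n c hc]
  exact A.sum_mem fun k _ => A.mul_mem (intCast_mem A _) (h k)

/-- `x` is a family of free generators of the numerical ring `R`. -/
def IsFreeOn {k : ℕ} (x : Fin k → R) : Prop :=
  ∀ (S : Type) [CommRing S] [NumericalRing S] (s : Fin k → S),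
    ∃! φ : R →+* S, IsNumericalHom φ ∧ ∀ i, φ (x i) = s i

variable {k : ℕ} {x : Fin k → R}

/-- The subring generated by the binomials of the generators is closed under all binomial
operations, so R maps to it by freeness; by uniqueness the composite with the inclusion is the
identity. -/
theorem IsFreeOn.adjoin_eq_top (hx : IsFreeOn x) (r : R) :
    r ∈ Algebra.adjoin ℤ {r : R | ∃ (n : ℕ) (i : Fin k), r = binom n (x i)} := by
  set U := {r : R | ∃ (n : ℕ) (i : Fin k), r = binom n (x i)}
  let A : Subring R := (Algebra.adjoin ℤ U).toSubring
  have hU (n : ℕ) (i : Fin k) : binom n (x i) ∈ A := Algebra.subset_adjoin ⟨n, i, rfl⟩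
  have hA : ∀ r ∈ A, ∀ n, binom n r ∈ A := by
    intro r hr
    change r ∈ binomSubring A
    refine (Algebra.adjoin_le (S := subalgebraOfSubring (binomSubring A)) ?_ :
      Algebra.adjoin ℤ U ≤ _) hr
    rintro _ ⟨n, i, rfl⟩
    exact binom_mem_binomSubring (fun n => hU n i) n
  let := NumericalRing.ofSubring A hA
  have hxA (i : Fin k) : x i ∈ A := by
    rw [← binom_index_one (x i)]
    exact hU 1 i
  obtain ⟨φ, ⟨hφ, hφx⟩, -⟩ := hx A fun i => ⟨x i, hxA i⟩
  have h : A.subtype.comp φ = RingHom.id R := by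
    refine (hx R x).unique ⟨?_, fun i => ?_⟩ ⟨fun n r => rfl, fun i => rfl⟩
    · exact IsNumericalHom.comp (fun n r => rfl) hφ
    · rw [RingHom.comp_apply, hφx]
      rfl
  have hr := congrArg (fun f : R →+* R => f r) h
  rw [← show A.subtype (φ r) = r from hr]
  exact (φ r).2

/-- The products of binomials of `x` span the free numerical ring. -/
theorem IsFreeOn.exists_eq_sum (hx : IsFreeOn x) (r : R) :
    ∃ c : (Fin k → ℕ) →₀ ℤ, r = c.sum fun n b => (b : R) * ∏ i, binom (n i) (x i) := by
  have h : r ∈ Submodule.span ℤ (Set.range fun n : Fin k → ℕ => ∏ i, binom (n i) (x i)) := by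
    have h1 : (1 : R) ∈
        Submodule.span ℤ (Set.range fun n : Fin k → ℕ => ∏ i, binom (n i) (x i)) :=
      Submodule.subset_span ⟨0, by simp [binom_index_zero]⟩
    refine adjoin_le_of_mul_mem h1 ?_ r (hx.adjoin_eq_top r)
    rintro _ ⟨m, j, rfl⟩ v hv
    induction hv using Submodule.span_induction with
    | mem v hv =>
      obtain ⟨n, rfl⟩ := hv
      -- Only the `j`-th factor changes: the product of two binomials of `x j` is again a linear
      -- combination of such binomials.
      obtain ⟨c, hc⟩ := exists_choose_mul_choose_eq_sum m (n j)
      beta_reduce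
      rw [← Finset.mul_prod_erase _ _ (Finset.mem_univ j), ← mul_assoc, binom_mul_binom m _ c hc,
        Finsupp.sum, Finset.sum_mul]
      refine sum_mem fun l _ => ?_
      have : binom l (x j) * ∏ i ∈ Finset.univ.erase j, binom (n i) (x i) =
          ∏ i, binom (Function.update n j l i) (x i) := by
        rw [← Finset.mul_prod_erase _ _ (Finset.mem_univ j), Function.update_self]
        congr 1
        refine Finset.prod_congr rfl fun i hi => ?_
        rw [Function.update_of_ne (Finset.ne_of_mem_erase hi)]
      rw [mul_assoc, this, ← zsmul_eq_mul]
      exact Submodule.smul_mem _ _ (Submodule.subset_span ⟨_, rfl⟩)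
    | zero => rw [mul_zero]; exact zero_mem _
    | add x y _ _ hx hy => rw [mul_add]; exact add_mem hx hy
    | smul a x _ hx => rw [mul_smul_comm]; exact Submodule.smul_mem _ _ hx
  rw [Finsupp.mem_span_range_iff_exists_finsupp] at h
  obtain ⟨c, hc⟩ := h
  exact ⟨c, by simpa [zsmul_eq_mul] using hc.symm⟩

/-- The numerical homomorphism sending the free generators `x` to `s`. -/
noncomputable def IsFreeOn.lift (hx : IsFreeOn x) {S : Type} [CommRing S] [NumericalRing S]
    (s : Fin k → S) : R →+* S := (hx S s).choose

variable {S T : Type} [CommRing S] [NumericalRing S] [CommRing T] [NumericalRing T]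

theorem IsFreeOn.isNumericalHom_lift (hx : IsFreeOn x) (s : Fin k → S) :
    IsNumericalHom (hx.lift s) := (hx S s).choose_spec.1.1

theorem IsFreeOn.lift_apply (hx : IsFreeOn x) (s : Fin k → S) (i : Fin k) :
    hx.lift s (x i) = s i := (hx S s).choose_spec.1.2 i

theorem IsFreeOn.comp_lift (hx : IsFreeOn x) (s : Fin k → S) (f : S →+* T)
    (hf : IsNumericalHom f) : f.comp (hx.lift s) = hx.lift fun i => f (s i) :=
  (hx T _).unique ⟨hf.comp (hx.isNumericalHom_lift s), fun i => by
    rw [RingHom.comp_apply, hx.lift_apply]⟩ ⟨hx.isNumericalHom_lift _, hx.lift_apply _⟩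

theorem IsFreeOn.lift_sum (hx : IsFreeOn x) (s : Fin k → S) (c : (Fin k → ℕ) →₀ ℤ) :
    hx.lift s (c.sum fun n b => (b : R) * ∏ i, binom (n i) (x i)) =
      c.sum fun n b => (b : S) * ∏ i, binom (n i) (s i) := by
  simp only [Finsupp.sum, map_sum, map_mul, map_intCast, map_prod, hx.isNumericalHom_lift s _ _,
    hx.lift_apply]

/-- An element of a free numerical ring whose values at all integral points are divisible by `m` is
divisible by `m`. -/
theorem IsFreeOn.dvd_of_forall_dvd_lift (hx : IsFreeOn x) (m : ℤ) (r : R)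
    (h : ∀ a : Fin k → ℤ, m ∣ hx.lift a r) : (m : R) ∣ r := by
  obtain ⟨c, rfl⟩ := hx.exists_eq_sum r
  simp only [hx.lift_sum] at h
  have hc := dvd_coeff_of_triangular (e := fun (n : Fin k → ℕ) (a : Fin k → ℤ) =>
    ∏ i, binom (n i) (a i)) (a := fun n i => (n i : ℤ))
    (fun n => Finset.prod_eq_one fun i _ => Int.choose_self (n i)) ?_ c m h
  · exact Finset.dvd_sum fun n _ => Dvd.dvd.mul_right
      ((Int.castRingHom R).map_dvd (hc n)) _
  · intro i j hij
    obtain ⟨l, hl⟩ := not_forall.1 (mt Pi.le_def.2 hij)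
    exact Finset.prod_eq_zero (Finset.mem_univ l) (Int.choose_eq_zero_of_lt (not_le.1 hl))

end NumericalRings

/-! ### Homomorphisms from a free numerical ring to ℤ_p and to ℤ/p. -/

section Reduction

variable {p : ℕ} [Fact p.Prime] {R : Type} [CommRing R] [NumericalRing R] {k : ℕ} {x : Fin k → R}

open NumericalRing

/-- The Frobenius of a free numerical ring is trivial mod `p`. -/
theorem IsFreeOn.exists_pow_eq_add (hx : IsFreeOn x) (r : R) : ∃ s : R, r ^ p = r + p * s := by
  obtain ⟨s, hs⟩ := hx.dvd_of_forall_dvd_lift p (r ^ p - r) fun a => by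
    rw [← ZMod.intCast_zmod_eq_zero_iff_dvd, map_sub, map_pow]
    push_cast
    rw [ZMod.pow_card, sub_self]
  exact ⟨s, by rw [eq_add_of_sub_eq' hs]; simp⟩

/-- Substituting `r = r ^ p - p * s` improves a congruence `f ≡ g` mod `p ^ n` on all of R to one
mod `p ^ (n + 1)`, as taking p-th powers and multiplying by p each gain a factor p. -/
theorem IsFreeOn.eq_of_toZMod_eq (hx : IsFreeOn x) (f g : R →+* ℤ_[p])
    (h : ∀ r, PadicInt.toZMod (f r) = PadicInt.toZMod (g r)) : f = g := by
  have key (n : ℕ) : ∀ r, (p : ℤ_[p]) ^ (n + 1) ∣ f r - g r := by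
    induction n with
    | zero => exact fun r => by simpa using (PadicInt.toZMod_eq_iff_dvd_sub _ _).1 (h r)
    | succ n ih =>
      intro r
      obtain ⟨s, hs⟩ := hx.exists_pow_eq_add (p := p) r
      have hf := congrArg f hs
      have hg := congrArg g hs
      simp only [map_pow, map_add, map_mul, map_natCast] at hf hg
      have h1 : f r - g r = (f r ^ p - g r ^ p) - p * (f s - g s) := by
        rw [hf, hg]
        ring
      rw [h1, ← geom_sum₂_mul]
      rw [pow_succ' _ (n + 1)]
      refine dvd_sub (mul_dvd_mul (dvd_geom_sum₂_self ?_) (ih r)) (mul_dvd_mul_left _ (ih s))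
      exact (PadicInt.toZMod_eq_iff_dvd_sub _ _).1 (h r)
  ext1 r
  rw [← sub_eq_zero]
  refine PadicInt.eq_zero_of_forall_pow_dvd _ fun n => ?_
  exact (pow_dvd_pow _ n.le_succ).trans (key n r)

/-- A homomorphism to `ℤ/p` is on finite sets given by evaluation at an integral point. -/
theorem IsFreeOn.exists_lift_eq (hx : IsFreeOn x) (φ : R →+* ZMod p) (s : Finset R) :
    ∃ a : Fin k → ℤ, ∀ r ∈ s, ((hx.lift a r : ℤ) : ZMod p) = φ r := by
  by_contra! hne
  choose c hc using fun r => ZMod.intCast_surjective (φ r)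
  have hp := (Fact.out : p.Prime).one_lt
  -- If no point works, some factor of this product vanishes mod p at each integral point by Fermat,
  -- so p divides the product; yet `φ` maps every factor to 1.
  obtain ⟨t, ht⟩ := hx.dvd_of_forall_dvd_lift p (∏ r ∈ s, (1 - (r - (c r : R)) ^ (p - 1)))
    fun a => by
      obtain ⟨r, hr, hra⟩ := hne a
      rw [← ZMod.intCast_zmod_eq_zero_iff_dvd, map_prod, Int.cast_prod]
      refine Finset.prod_eq_zero hr ?_
      simp only [map_sub, map_one, map_pow, map_intCast]
      push_cast
      rw [hc, ZMod.pow_card_sub_one_eq_one (sub_ne_zero.2 hra), sub_self]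
  have h := congrArg φ ht
  simp only [map_prod, map_sub, map_one, map_pow, map_mul, map_intCast, hc, sub_self] at h
  rw [zero_pow (by omega)] at h
  simp at h

theorem PadicInt.isClosed_toZMod_eq (c : ZMod p) :
    IsClosed {y : ℤ_[p] | PadicInt.toZMod y = c} := by
  obtain ⟨y₀, rfl⟩ := ZMod.ringHom_surjective PadicInt.toZMod c
  have : {y : ℤ_[p] | PadicInt.toZMod y = PadicInt.toZMod y₀} = Metric.ball y₀ 1 := by
    ext y
    rw [Set.mem_ofPred_eq, PadicInt.toZMod_eq_iff_dvd_sub, ← PadicInt.norm_lt_one_iff_dvd,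
      Metric.mem_ball, dist_eq_norm]
  rw [this]
  exact IsUltrametricDist.isClosed_ball _ _

theorem IsFreeOn.continuous_lift (hx : IsFreeOn x) (r : R) :
    Continuous fun t : Fin k → ℤ_[p] => hx.lift t r := by
  obtain ⟨c, rfl⟩ := hx.exists_eq_sum r
  simp only [hx.lift_sum]
  unfold Finsupp.sum
  exact continuous_finsetSum _ fun n _ => continuous_const.mul <|
    continuous_finsetProd _ fun i _ => (PadicInt.continuous_choose (n i)).comp (continuous_apply i)

/-- The points of ℤ_p^k whose evaluation agrees mod p with `φ` at a given `r` form a closed set;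
finitely many such sets meet by `IsFreeOn.exists_lift_eq`, so compactness gives a common point. -/
theorem IsFreeOn.exists_toZMod_eq (hx : IsFreeOn x) (φ : R →+* ZMod p) :
    ∃ f : R →+* ℤ_[p], ∀ r, PadicInt.toZMod (f r) = φ r := by
  obtain ⟨t, -, ht⟩ := (isCompact_univ (X := Fin k → ℤ_[p])).inter_iInter_nonempty
    (fun r : R => {t | PadicInt.toZMod (hx.lift t r) = φ r})
    (fun r => (PadicInt.isClosed_toZMod_eq (φ r)).preimage (hx.continuous_lift r)) fun s => by
      obtain ⟨a, ha⟩ := hx.exists_lift_eq φ s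
      refine ⟨fun i => (a i : ℤ_[p]), Set.mem_univ _, Set.mem_iInter₂.2 fun r hr => ?_⟩
      have h := RingHom.congr_fun (hx.comp_lift a _ (isNumericalHom_intCast p)) r
      simp only [RingHom.comp_apply, eq_intCast] at h
      rw [Set.mem_ofPred_eq, ← h, map_intCast, ha r hr]
  exact ⟨hx.lift t, fun r => Set.mem_iInter.1 ht r⟩

end Reduction

/-! ### Translation to points of affine schemes, and the theorem. -/

section Schemes

theorem AlgebraicGeometry.bijective_specMap_comp {Y : Scheme.{0}} {B A C : CommRingCat.{0}}
    (e : Y ≅ Spec B) (φ : A ⟶ C) (h : Function.Bijective fun α : B ⟶ A => α ≫ φ) :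
    Function.Bijective fun g : Spec A ⟶ Y => Spec.map φ ≫ g := by
  constructor
  · intro g g' hg
    have hg' : Spec.map (Spec.preimage (g ≫ e.hom) ≫ φ) =
        Spec.map (Spec.preimage (g' ≫ e.hom) ≫ φ) := by
      simpa using congrArg (· ≫ e.hom) hg
    have := congrArg Spec.map (h.1 (Spec.map_injective hg'))
    simpa using this
  · intro g
    obtain ⟨α, hα⟩ := h.2 (Spec.preimage (g ≫ e.hom))
    refine ⟨Spec.map α ≫ e.inv, ?_⟩
    have := congrArg Spec.map hα
    simp only [Spec.map_comp, Spec.map_preimage] at this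
    simp [reassoc_of% this]

theorem bijective_reductionModP (p : ℕ) [Fact p.Prime] (X : SimplicialObject Scheme.{0})
    (hX : IsNumericalSimplicialScheme X) (n : SimplexCategory) :
    Function.Bijective ((reductionModP p X).app (op n)) := by
  obtain ⟨R, hR, -, hfree, ⟨e⟩⟩ := hX
  obtain ⟨k, x, hx⟩ := hfree n
  have hx : IsFreeOn x := hx
  refine AlgebraicGeometry.bijective_specMap_comp (e.app (op n))
    (CommRingCat.ofHom (PadicInt.toZMod (p := p))) ⟨fun α β hαβ => ?_, fun φ => ?_⟩
  · ext1
    exact hx.eq_of_toZMod_eq α.hom β.hom fun r => ConcreteCategory.congr_hom hαβ r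
  · obtain ⟨f, hf⟩ := hx.exists_toZMod_eq φ.hom
    exact ⟨CommRingCat.ofHom f, by ext r; exact hf r⟩

end Schemes

theorem mainTheorem10 (p : ℕ) [Fact p.Prime] :
    (∀ X : SimplicialObject Scheme.{0}, IsNumericalSimplicialScheme X →
      ∀ n : SimplexCategory, Function.Bijective ((reductionModP p X).app (op n))) ∧
    (∀ X : SimplicialObject (PadicNum p), IsPadicNumericalSpace X →
      ∀ i : ℕ, IsIso (toOrdinaryCohomology (continuousFunctions p) X i)) :=
  ⟨bijective_reductionModP p, fun X hX =>
    isIso_toOrdinaryCohomology_continuousFunctions X hX.isIso_cohomology⟩
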